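/- Let $c\ge 1$ be an integer. For a prime $p$, let $L=\mathfrak f_{c,2}(\mathbb F_p)$ be the free nilpotent Lie algebra of class $c$ on two generators over $\mathbb F_p$, i.e. the free Lie $\mathbb F_p$-algebra on two generators modulo the $(c+1)$-st term of its lower central series. Write $L=L_1\oplus\cdots\oplus L_c$, where $L_k$ is the span of all $k$-fold Lie monomials in the generators, and put $d_k=\dim_{\mathbb F_p}L_k$. For $1\le k\le c-1$, write $I\triangleleft_{k,1}L$ if $I$ is an ideal of $L$ of the form $$I=0\oplus\cdots\oplus 0\oplus I_k\oplus I_{k+1}\oplus L_{k+2}\oplus\cdots\oplus L_c,\qquad I_k\le L_k,\ I_{k+1}\le L_{k+1}.$$ The one-step graded ideal zeta function of $L$ is $$\zeta^{\triangleleft_1}_{\mathfrak f_{c,2}(\mathbb F_p)}(s)=\sum_{k=1}^{c-1}\ \sum_{I\triangleleft_{k,1}L}|L_k:I_k|^{-s}\,|L_{k+1}:I_{k+1}|^{-s}\qquad(s\in\mathbb C).$$ For $a\ge 0$ let $\alpha_1(a,k,p)$ be the number of $I\triangleleft_{k,1}L$ with $\dim I_k+\dim I_{k+1}=a$. Then: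 (i) there is a polynomial $W(X,Y)\in\mathbb Q[X,Y]$, depending only on $c$, such that for all but finitely many primes $p$ $$\zeta^{\triangleleft_1}_{\mathfrak f_{c,2}(\mathbb F_p)}(s)=W(p,p^{-s})\quad\text{for all } s\in\mathbb C;$$ (ii) for every prime $p$ and every $s\in\mathbb C$, with $t=p^{-s}$, $$\zeta^{\triangleleft_1}_{\mathfrak f_{c,2}(\mathbb F_p)}(s)=\sum_{k=1}^{c-1}\ \sum_{a=0}^{d_k+d_{k+1}}\alpha_1(a,k,p)\,t^{\,d_k+d_{k+1}-a}.$$ -/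

import Mathlib

open scoped BigOperators

noncomputable section

/-- The free nilpotent Lie algebra of class `c` on two generators over `R`: the free Lie algebra
`L` on two generators modulo `γ_{c+1}(L)`. (The lower central series of Mathlib is indexed from
`0`, so that `γ_{c+1}(L)` is its term of index `c`.) -/
abbrev FreeNilpotentLie (R : Type) [CommRing R] (c : ℕ) : Type :=
  FreeLieAlgebra R (Fin 2) ⧸
    (LieModule.lowerCentralSeries R (FreeLieAlgebra R (Fin 2)) (FreeLieAlgebra R (Fin 2)) c :
      LieIdeal R (FreeLieAlgebra R (Fin 2)))

namespace FreeNilpotentLie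

/-- The two standard generators. -/
def gen (R : Type) [CommRing R] (c : ℕ) (i : Fin 2) : FreeNilpotentLie R c :=
  LieSubmodule.Quotient.mk (FreeLieAlgebra.of R i)

/-- `IsMonomial R c k w`: the element `w` is a bracketing, in any arrangement, of `k` generators. -/
inductive IsMonomial (R : Type) [CommRing R] (c : ℕ) : ℕ → FreeNilpotentLie R c → Prop
  | gen (i : Fin 2) : IsMonomial R c 1 (gen R c i)
  | lie {m n : ℕ} {v w : FreeNilpotentLie R c} :
      IsMonomial R c m v → IsMonomial R c n w → IsMonomial R c (m + n) ⁅v, w⁆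

/-- The homogeneous component `L_k` of weight `k`, spanned by all Lie monomials of weight `k`. -/
def component (R : Type) [CommRing R] (c k : ℕ) : Submodule R (FreeNilpotentLie R c) :=
  Submodule.span R {w | IsMonomial R c k w}

/-- `I` is an `n`-step graded ideal at position `k`:
`I = 0 ⊕ ⋯ ⊕ 0 ⊕ I_k ⊕ ⋯ ⊕ I_{k+n} ⊕ L_{k+n+1} ⊕ ⋯ ⊕ L_c` with `I_j ≤ L_j`. -/
def IsStepGraded (R : Type) [CommRing R] (c n k : ℕ) (I : LieIdeal R (FreeNilpotentLie R c)) :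
    Prop :=
  ∃ J : ℕ → Submodule R (FreeNilpotentLie R c),
    (∀ j, J j ≤ component R c j) ∧
    (∀ j, j < k → J j = ⊥) ∧
    (∀ j, k + n < j → J j = component R c j) ∧
    I.toSubmodule = ⨆ j ∈ Finset.Icc 1 c, J j

/-- The homogeneous part `I_j = I ∩ L_j` of an ideal. -/
def part {R : Type} [CommRing R] {c : ℕ} (I : LieIdeal R (FreeNilpotentLie R c)) (j : ℕ) :
    Submodule R (FreeNilpotentLie R c) :=
  I.toSubmodule ⊓ component R c j

/-- The index `|L_j : I_j|`. -/
def partIndex {R : Type} [CommRing R] {c : ℕ} (I : LieIdeal R (FreeNilpotentLie R c)) (j : ℕ) :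
    ℕ :=
  (part I j).toAddSubgroup.relIndex (component R c j).toAddSubgroup

/-- The `n`-step graded ideal zeta function of the free class-`c` nilpotent Lie algebra on two
generators over `𝔽_p`:
`∑_{k=1}^{c-n} ∑_I |L_k : I_k|^{-s} ⋯ |L_{k+n} : I_{k+n}|^{-s}`,
the inner sum being over the `n`-step graded ideals `I` at position `k`. It is a finite sum, as
`finite_lieIdeal` below shows. -/
def stepZeta (n c p : ℕ) (s : ℂ) : ℂ :=
  ∑ k ∈ Finset.Icc 1 (c - n),
    ∑ᶠ I ∈ {I : LieIdeal (ZMod p) (FreeNilpotentLie (ZMod p) c) | IsStepGraded (ZMod p) c n k I},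
      ∏ j ∈ Finset.Icc k (k + n), (partIndex I j : ℂ) ^ (-s)

/-- The dimension `d_k` of `L_k` over `𝔽_p`. -/
def componentDim (c p k : ℕ) : ℕ :=
  Module.finrank (ZMod p) (component (ZMod p) c k)

/-- `α_n(a, k, p)`: the number of `n`-step graded ideals `I` at position `k` with
`dim I_k + ⋯ + dim I_{k+n} = a`. -/
def stepCount (n c a k p : ℕ) : ℕ :=
  Set.ncard {I : LieIdeal (ZMod p) (FreeNilpotentLie (ZMod p) c) |
    IsStepGraded (ZMod p) c n k I ∧
      ∑ j ∈ Finset.Icc k (k + n), Module.finrank (ZMod p) (part I j) = a}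

section Finiteness

variable (R : Type) [CommRing R]

theorem lie_mem_of_mem_one {k : ℕ} {u n : FreeLieAlgebra R (Fin 2)}
    (hu : u ∈ LieModule.lowerCentralSeries R (FreeLieAlgebra R (Fin 2))
      (FreeLieAlgebra R (Fin 2)) 1)
    (hn : n ∈ LieModule.lowerCentralSeries R (FreeLieAlgebra R (Fin 2))
      (FreeLieAlgebra R (Fin 2)) k) :
    ⁅u, n⁆ ∈ LieModule.lowerCentralSeries R (FreeLieAlgebra R (Fin 2))
      (FreeLieAlgebra R (Fin 2)) (k + 2) := by
  have key : ∀ {m : ℕ} (x y : FreeLieAlgebra R (Fin 2)),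
      y ∈ LieModule.lowerCentralSeries R (FreeLieAlgebra R (Fin 2))
        (FreeLieAlgebra R (Fin 2)) m →
      ⁅x, y⁆ ∈ LieModule.lowerCentralSeries R (FreeLieAlgebra R (Fin 2))
        (FreeLieAlgebra R (Fin 2)) (m + 1) := by
    intro m x y hy
    rw [LieModule.lowerCentralSeries_succ]
    exact LieSubmodule.lie_mem_lie (LieSubmodule.mem_top x) hy
  rw [LieModule.lowerCentralSeries_succ, ← LieSubmodule.mem_toSubmodule,
    LieSubmodule.lieIdeal_oper_eq_linear_span'] at hu
  induction hu using Submodule.span_induction with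
  | mem x hx =>
    obtain ⟨a, -, b, -, rfl⟩ := hx
    rw [lie_lie]
    exact sub_mem (key _ _ (key _ _ hn)) (key _ _ (key _ _ hn))
  | zero => rw [zero_lie]; exact zero_mem _
  | add x y _ _ hx hy => rw [add_lie]; exact add_mem hx hy
  | smul t x _ hx => rw [smul_lie]; exact SMulMemClass.smul_mem t hx

theorem mem_span_sup (x : FreeLieAlgebra R (Fin 2)) :
    x ∈ Submodule.span R (Set.range (FreeLieAlgebra.of R (X := Fin 2))) ⊔
      (LieModule.lowerCentralSeries R (FreeLieAlgebra R (Fin 2))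
        (FreeLieAlgebra R (Fin 2)) 1).toSubmodule := by
  let K : LieSubalgebra R (FreeLieAlgebra R (Fin 2)) :=
    { (Submodule.span R (Set.range (FreeLieAlgebra.of R (X := Fin 2))) ⊔
        (LieModule.lowerCentralSeries R (FreeLieAlgebra R (Fin 2))
          (FreeLieAlgebra R (Fin 2)) 1).toSubmodule) with
      lie_mem' := by
        intro a b _ _
        refine Submodule.mem_sup_right ?_
        rw [LieModule.lowerCentralSeries_succ]
        exact LieSubmodule.lie_mem_lie (LieSubmodule.mem_top a) (LieSubmodule.mem_top b) }
  have hK : ∀ i : Fin 2, FreeLieAlgebra.of R i ∈ K := fun i =>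
    Submodule.mem_sup_left (Submodule.subset_span ⟨i, rfl⟩)
  have h : K.incl.comp (FreeLieAlgebra.lift R fun i => (⟨_, hK i⟩ : K)) = LieHom.id := by
    ext i
    simp
  have hx := congrArg (fun f : FreeLieAlgebra R (Fin 2) →ₗ⁅R⁆ FreeLieAlgebra R (Fin 2) => f x) h
  have hx' : ((FreeLieAlgebra.lift R (fun i => (⟨_, hK i⟩ : K)) x : K) :
      FreeLieAlgebra R (Fin 2)) = x := hx
  rw [← hx']
  exact (FreeLieAlgebra.lift R (fun i => (⟨_, hK i⟩ : K)) x).2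

theorem exists_fg_le_sup (k : ℕ) : ∃ S : Submodule R (FreeLieAlgebra R (Fin 2)), S.FG ∧
    (LieModule.lowerCentralSeries R (FreeLieAlgebra R (Fin 2))
      (FreeLieAlgebra R (Fin 2)) k).toSubmodule ≤ S ⊔
    (LieModule.lowerCentralSeries R (FreeLieAlgebra R (Fin 2))
      (FreeLieAlgebra R (Fin 2)) (k + 1)).toSubmodule := by
  have hG : (Submodule.span R (Set.range (FreeLieAlgebra.of R (X := Fin 2)))).FG :=
    Submodule.fg_span (Set.finite_range _)
  induction k with
  | zero => exact ⟨_, hG, fun x _ => mem_span_sup R x⟩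
  | succ k ih =>
    obtain ⟨S, hS, hle⟩ := ih
    refine ⟨_, hG.map₂ (LieModule.toEnd R (FreeLieAlgebra R (Fin 2))
      (FreeLieAlgebra R (Fin 2)) : FreeLieAlgebra R (Fin 2) →ₗ[R] _) hS, ?_⟩
    conv_lhs => rw [LieModule.lowerCentralSeries_succ, LieSubmodule.lieIdeal_oper_eq_linear_span']
    rw [Submodule.span_le]
    rintro _ ⟨x, -, n, hn, rfl⟩
    obtain ⟨g, hg, u, hu, rfl⟩ := Submodule.mem_sup.1 (mem_span_sup R x)
    have hun := lie_mem_of_mem_one R hu hn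
    obtain ⟨t, ht, v, hv, rfl⟩ := Submodule.mem_sup.1 (hle hn)
    rw [add_lie]
    refine add_mem ?_ (Submodule.mem_sup_right hun)
    rw [lie_add]
    refine add_mem (Submodule.mem_sup_left ?_) (Submodule.mem_sup_right ?_)
    · exact Submodule.apply_mem_map₂ _ hg ht
    · rw [LieModule.lowerCentralSeries_succ]
      exact LieSubmodule.lie_mem_lie (LieSubmodule.mem_top g) hv

theorem exists_fg_sup_eq_top (c : ℕ) : ∃ T : Submodule R (FreeLieAlgebra R (Fin 2)), T.FG ∧
    T ⊔ (LieModule.lowerCentralSeries R (FreeLieAlgebra R (Fin 2))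
      (FreeLieAlgebra R (Fin 2)) c).toSubmodule = ⊤ := by
  induction c with
  | zero => exact ⟨⊥, Submodule.fg_bot, by simp⟩
  | succ c ih =>
    obtain ⟨T, hT, h⟩ := ih
    obtain ⟨S, hS, hle⟩ := exists_fg_le_sup R c
    refine ⟨T ⊔ S, hT.sup hS, top_le_iff.1 ?_⟩
    rw [← h, sup_assoc]
    exact sup_le_sup_left hle T

/-- The free nilpotent Lie algebra is a finitely generated module. -/
instance module_finite (c : ℕ) : Module.Finite R (FreeNilpotentLie R c) := by
  obtain ⟨T, hT, h⟩ := exists_fg_sup_eq_top R c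
  refine ⟨?_⟩
  have hs : Submodule.map ((LieSubmodule.Quotient.mk' (LieModule.lowerCentralSeries R
      (FreeLieAlgebra R (Fin 2)) (FreeLieAlgebra R (Fin 2)) c) :
      FreeLieAlgebra R (Fin 2) →ₗ[R] FreeNilpotentLie R c)) T = ⊤ := by
    rw [eq_top_iff]
    rintro y -
    obtain ⟨x, rfl⟩ := LieSubmodule.Quotient.surjective_mk' _ y
    have hx : x ∈ T ⊔ (LieModule.lowerCentralSeries R (FreeLieAlgebra R (Fin 2))
      (FreeLieAlgebra R (Fin 2)) c).toSubmodule := h ▸ Submodule.mem_top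
    obtain ⟨t, ht, v, hv, rfl⟩ := Submodule.mem_sup.1 hx
    refine ⟨t, ht, ?_⟩
    have hv0 := (LieSubmodule.Quotient.mk_eq_zero (N := LieModule.lowerCentralSeries R
      (FreeLieAlgebra R (Fin 2)) (FreeLieAlgebra R (Fin 2)) c) (m := v)).2 hv
    rw [map_add, hv0, add_zero]
    rfl
  rw [← hs]
  exact hT.map _

/-- There are only finitely many ideals over `𝔽_p`, so no sum or count above degenerates. -/
theorem finite_lieIdeal (c p : ℕ) [NeZero p] :
    Finite (LieIdeal (ZMod p) (FreeNilpotentLie (ZMod p) c)) := by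
  have : Finite (FreeNilpotentLie (ZMod p) c) := Module.finite_of_finite (ZMod p)
  exact Finite.of_injective _ (SetLike.coe_injective
    (A := LieIdeal (ZMod p) (FreeNilpotentLie (ZMod p) c)))

end Finiteness

end FreeNilpotentLie

end

/-!
Part (ii) only regroups a finite sum, because `|L_j : I_j|` is the power `p ^ (d_j - dim I_j)`.
By (ii), part (i) reduces to two facts: for large `p` the dimensions `d_k` do not depend on `p`, and
the numbers of ideals of given dimension are polynomials in `p`.

Assume `p > c`. The free Lie algebra maps to the free associative algebra, and the Dynkin operator,
which sends a word to its right-normed bracket, is multiplication by `n` on the image of the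
weight-`n` part (`dynkin_assoc`). Hence for `1 ≤ n ≤ c` an element of `L_n` is determined by its
coefficients on words of length `n`, the components of the free nilpotent Lie algebra are
independent, and `n d_n` is the trace of an integral matrix that does not depend on `p`, read
modulo `p`. As `d_n ≤ 2 ^ n`, this determines `d_n` for all large `p` (`exists_finrank_weight_eq`).

By independence, a one-step graded ideal at position `k` is a pair `A ≤ L_k`, `B ≤ L_{k+1}` with
`⁅x, A⁆ + ⁅y, A⁆ ≤ B` (`bijOn_partPair`). Let `K` be the kernel of
`L_k × L_k → L_{k+1}, (u, v) ↦ ⁅x, u⁆ + ⁅y, v⁆`; this map is onto. The number of `B` for a given `A`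
depends only on `dim A` and on `dim ((A × A) ∩ K)`. For `k ≥ 2` the map
`K × K → L_k, (d, e) ↦ d.1 + e.2` is injective (`eq_zero_of_lie_add_lie_eq_zero`): if
`⁅x, u⁆ + ⁅y, v⁆ = 0` and `⁅x, w⁆ = ⁅y, u⁆`, then in the free associative algebra `x u + y v` and
`x w - y u` are cyclically invariant, which forces the coefficients of `u` to be symmetric in the
last two letters. The Dynkin operator kills such an element, so `u = 0`, and then `v = w = 0` for a
similar reason.

Consequently a subspace `S ≤ K` lies in `A × A` exactly if `A` contains the span of all
coordinates of its elements, which has dimension `2 dim S`. Writing the number of `B` as a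
combination of Gaussian binomials in `dim ((A × A) ∩ K)` and interchanging the sums over `A` and
over `S ≤ (A × A) ∩ K` leaves only numbers of subspaces contained in, or containing, a given one:
Gaussian binomials evaluated at `p` (`exists_polynomial_card_pencilPair`). For `k = 1` every nonzero
`A` generates `L_2` and the count is immediate.
-/

noncomputable section

open Module

/-! ### Gaussian binomial coefficients -/

/-- The Gaussian binomial coefficient as an integral polynomial, defined by the `q`-Pascal rule. -/
def gaussBinom : ℕ → ℕ → Polynomial ℤ
  | _, 0 => 1
  | 0, _ + 1 => 0
  | n + 1, k + 1 => gaussBinom n k + Polynomial.X ^ (k + 1) * gaussBinom n (k + 1)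

@[simp] theorem gaussBinom_zero_right (n : ℕ) : gaussBinom n 0 = 1 := by
  cases n <;> rfl

theorem gaussBinom_succ_succ (n k : ℕ) :
    gaussBinom (n + 1) (k + 1) =
      gaussBinom n k + Polynomial.X ^ (k + 1) * gaussBinom n (k + 1) := rfl

theorem gaussBinom_eq_zero {n k : ℕ} (h : n < k) : gaussBinom n k = 0 := by
  induction n generalizing k with
  | zero => obtain ⟨k, rfl⟩ := Nat.exists_eq_succ_of_ne_zero h.ne'; rfl
  | succ n ih =>
    obtain ⟨k, rfl⟩ := Nat.exists_eq_succ_of_ne_zero (Nat.zero_lt_of_lt h).ne'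
    rw [Nat.succ_eq_add_one, gaussBinom_succ_succ, ih (by omega), ih (by omega)]; simp

theorem gaussBinom_self (n : ℕ) : gaussBinom n n = 1 := by
  induction n with
  | zero => rfl
  | succ n ih => rw [gaussBinom_succ_succ, ih, gaussBinom_eq_zero n.lt_succ_self]; simp

theorem prod_pow_sub_pow_succ (q : ℤ) (n k : ℕ) :
    ∏ i ∈ Finset.range (k + 1), (q ^ (n + 1) - q ^ i) =
      (q ^ (n + 1) - 1) * q ^ k * ∏ i ∈ Finset.range k, (q ^ n - q ^ i) := by
  rw [Finset.prod_range_succ']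
  have : ∀ i ∈ Finset.range k, q ^ (n + 1) - q ^ (i + 1) = q * (q ^ n - q ^ i) := by
    intro i _; ring
  rw [Finset.prod_congr rfl this, Finset.prod_mul_distrib]
  simp
  ring

theorem eval_gaussBinom_mul_prod (q : ℤ) (n k : ℕ) :
    (gaussBinom n k).eval q * ∏ i ∈ Finset.range k, (q ^ k - q ^ i) =
      ∏ i ∈ Finset.range k, (q ^ n - q ^ i) := by
  induction n generalizing k with
  | zero =>
    cases k with
    | zero => simp
    | succ k =>
      rw [gaussBinom_eq_zero (Nat.succ_pos k), Finset.prod_range_succ']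
      simp [Finset.prod_range_succ']
  | succ n ih =>
    cases k with
    | zero => simp
    | succ k =>
      have h1 := ih k
      have h2 := ih (k + 1)
      rw [Finset.prod_range_succ (fun i => q ^ n - q ^ i), prod_pow_sub_pow_succ] at h2
      rw [prod_pow_sub_pow_succ, prod_pow_sub_pow_succ, gaussBinom_succ_succ]
      simp only [Polynomial.eval_add, Polynomial.eval_mul, Polynomial.eval_pow, Polynomial.eval_X]
      linear_combination ((q ^ (k + 1) - 1) * q ^ k) * h1 + q ^ (k + 1) * h2

/-- The coefficients `g` with `f m = ∑ i ≤ m, gaussBinom m i * g i`. -/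
def gaussInverse (f : ℕ → Polynomial ℤ) (m : ℕ) : Polynomial ℤ :=
  f m - ∑ i : Fin m, gaussBinom m i * gaussInverse f i

theorem sum_gaussBinom_mul_gaussInverse (f : ℕ → Polynomial ℤ) (m : ℕ) :
    ∑ i ∈ Finset.range (m + 1), gaussBinom m i * gaussInverse f i = f m := by
  rw [Finset.sum_range_succ, gaussBinom_self, one_mul, gaussInverse.eq_1 f m, Finset.sum_range]
  ring

/-! ### Counting subspaces -/

section Count

variable {F V : Type*} [Field F] [Fintype F] [AddCommGroup V] [Module F V] [Finite V]

/-- The linearly independent `k`-tuples of `V` with span `S` are the linearly independent `k`-tuples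
of the `k`-dimensional subspace `S`. -/
def linearIndependentFiberEquiv (k : ℕ) (S : {S : Submodule F V // finrank F S = k}) :
    {s : {s : Fin k → V // LinearIndependent F s} //
      (⟨Submodule.span F (Set.range s.1), by rw [finrank_span_eq_card s.2, Fintype.card_fin]⟩ :
        {S : Submodule F V // finrank F S = k}) = S} ≃
    {t : Fin k → S.1 // LinearIndependent F t} where
  toFun s := ⟨fun i => ⟨s.1.1 i, by
      have h := congrArg Subtype.val s.2
      rw [← h]; exact Submodule.subset_span ⟨i, rfl⟩⟩,
    LinearIndependent.of_comp S.1.subtype s.1.2⟩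
  invFun t := ⟨⟨fun i => t.1 i, t.2.map' S.1.subtype (Submodule.ker_subtype _)⟩, by
    apply Subtype.ext
    refine Submodule.eq_of_le_of_finrank_eq (Submodule.span_le.2 ?_) ?_
    · rintro _ ⟨i, rfl⟩; exact (t.1 i).2
    · exact (finrank_span_eq_card (t.2.map' S.1.subtype (Submodule.ker_subtype _))).trans
        ((Fintype.card_fin k).trans S.2.symm)⟩
  left_inv _ := rfl
  right_inv _ := rfl

theorem card_submodule_finrank_eq (k : ℕ) :
    (Nat.card {S : Submodule F V // finrank F S = k} : ℤ) =
      (gaussBinom (finrank F V) k).eval (Fintype.card F : ℤ) := by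
  classical
  have : Finite (Submodule F V) := Finite.of_injective _ (SetLike.coe_injective)
  let _ : Fintype {S : Submodule F V // finrank F S = k} := Fintype.ofFinite _
  have hq : 1 < Fintype.card F := Fintype.one_lt_card
  have hcast : ∀ n, k ≤ n → ((∏ i : Fin k, (Fintype.card F ^ n - Fintype.card F ^ i.val) : ℕ) : ℤ) =
      ∏ i ∈ Finset.range k, ((Fintype.card F : ℤ) ^ n - (Fintype.card F : ℤ) ^ i) := by
    intro n hn
    rw [Finset.prod_range, Nat.cast_prod]
    refine Finset.prod_congr rfl fun i _ => ?_
    rw [Nat.cast_sub (Nat.pow_le_pow_right hq.le (by omega))]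
    push_cast; rfl
  rcases lt_or_ge (finrank F V) k with h | h
  · rw [gaussBinom_eq_zero h]
    have : IsEmpty {S : Submodule F V // finrank F S = k} :=
      ⟨fun S => absurd (S.1.finrank_le) (by rw [S.2]; omega)⟩
    simp
  · have h1 := card_linearIndependent (K := F) (V := V) h
    rw [Nat.card_congr (Equiv.sigmaFiberEquiv
      (fun s : {s : Fin k → V // LinearIndependent F s} =>
        (⟨Submodule.span F (Set.range s.1), by rw [finrank_span_eq_card s.2, Fintype.card_fin]⟩ :
        {S : Submodule F V // finrank F S = k}))).symm, Nat.card_sigma] at h1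
    have h2 : ∀ S : {S : Submodule F V // finrank F S = k},
        Nat.card {t : Fin k → S.1 // LinearIndependent F t} =
        ∏ i : Fin k, (Fintype.card F ^ k - Fintype.card F ^ i.val) := by
      intro S
      have := card_linearIndependent (K := F) (V := S.1) (k := k) S.2.ge
      rwa [S.2] at this
    rw [Finset.sum_congr rfl (fun S _ => (Nat.card_congr (linearIndependentFiberEquiv k S)).trans
      (h2 S)), Finset.sum_const, smul_eq_mul, Finset.card_univ, ← Nat.card_eq_fintype_card] at h1
    have h3 := congrArg (Nat.cast : ℕ → ℤ) h1
    rw [Nat.cast_mul, hcast _ le_rfl, hcast _ h, ← eval_gaussBinom_mul_prod _ (finrank F V)] at h3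
    refine mul_right_cancel₀ (Finset.prod_ne_zero_iff.2 fun i hi => ?_) h3
    rw [Finset.mem_range] at hi
    have : (Fintype.card F : ℤ) ^ i < (Fintype.card F : ℤ) ^ k :=
      pow_lt_pow_right₀ (by exact_mod_cast hq) hi
    omega

omit [Fintype F] in
theorem finrank_comap_mkQ (C : Submodule F V) (T : Submodule F (V ⧸ C)) :
    finrank F (T.comap C.mkQ) = finrank F C + finrank F T := by
  have h := LinearMap.finrank_range_add_finrank_ker (C.mkQ.domRestrict (T.comap C.mkQ))
  have h1 : LinearMap.range (C.mkQ.domRestrict (T.comap C.mkQ)) = T := by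
    rw [LinearMap.range_domRestrict, Submodule.map_comap_eq, Submodule.range_mkQ, top_inf_eq]
  have h2 : finrank F (LinearMap.ker (C.mkQ.domRestrict (T.comap C.mkQ))) = finrank F C := by
    rw [LinearMap.ker_domRestrict, Submodule.ker_mkQ]
    exact (Submodule.comapSubtypeEquivOfLe (Submodule.le_comap_mkQ C T)).finrank_eq
  rw [h1, h2] at h
  omega

/-- The number of `b`-dimensional subspaces containing a given one. -/
theorem card_submodule_ge_finrank_eq (C : Submodule F V) (b : ℕ) :
    (Nat.card {S : Submodule F V // C ≤ S ∧ finrank F S = b} : ℤ) =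
      if finrank F C ≤ b then
        (gaussBinom (finrank F V - finrank F C) (b - finrank F C)).eval (Fintype.card F : ℤ)
      else 0 := by
  split_ifs with h
  · have : Finite (V ⧸ C) := Finite.of_surjective _ C.mkQ_surjective
    let e : Submodule F (V ⧸ C) ≃ {S : Submodule F V // C ≤ S} :=
      (Submodule.comapMkQRelIso C).toEquiv
    rw [← Submodule.finrank_quotient, ← card_submodule_finrank_eq]
    congr 1
    refine (Nat.card_congr ?_).symm
    refine (e.subtypeEquiv (q := fun S => finrank F S.1 = b) fun T => ?_).trans
      (Equiv.subtypeSubtypeEquivSubtypeInter (fun S => C ≤ S) (fun S => finrank F S = b))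
    change _ ↔ finrank F (T.comap C.mkQ) = b
    rw [finrank_comap_mkQ]; omega
  · have : IsEmpty {S : Submodule F V // C ≤ S ∧ finrank F S = b} :=
      ⟨fun S => h (S.2.2 ▸ Submodule.finrank_mono S.2.1)⟩
    simp

theorem card_submodule_le_finrank_eq (M : Submodule F V) (i : ℕ) :
    (Nat.card {S : Submodule F V // S ≤ M ∧ finrank F S = i} : ℤ) =
      (gaussBinom (finrank F M) i).eval (Fintype.card F : ℤ) := by
  rw [← card_submodule_finrank_eq]
  congr 1
  let e : Submodule F M ≃ {S : Submodule F V // S ≤ M} := (Submodule.mapIic M).toEquiv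
  refine (Nat.card_congr ?_).symm
  refine (e.subtypeEquiv (q := fun S => finrank F S.1 = i) fun T => ?_).trans
    (Equiv.subtypeSubtypeEquivSubtypeInter (fun S => S ≤ M) (fun S => finrank F S = i))
  change _ ↔ finrank F (T.map M.subtype) = i
  rw [Submodule.finrank_map_subtype_eq]

end Count

/-! ### Pairs of subspaces compatible with a pencil of linear maps -/

section Pencil

variable {F U W : Type*} [Field F] [AddCommGroup U] [Module F U] [AddCommGroup W] [Module F W]

theorem finrank_prod_submodule [FiniteDimensional F U] (A : Submodule F U) :
    finrank F (A.prod A) = 2 * finrank F A := by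
  have h : LinearMap.range (A.subtype.prodMap A.subtype) = A.prod A := by
    rw [LinearMap.range_prodMap, Submodule.range_subtype]
  rw [← h, LinearMap.finrank_range_of_inj
    (Prod.map_injective.2 ⟨A.subtype_injective, A.subtype_injective⟩), finrank_prod, two_mul]

/-- Rank-nullity for the pencil `(X, Y)` restricted to `A × A`. -/
theorem finrank_map_sup_map_add_finrank [FiniteDimensional F U] (X Y : U →ₗ[F] W)
    (A : Submodule F U) :
    finrank F (A.map X ⊔ A.map Y : Submodule F W) +
      finrank F (A.prod A ⊓ LinearMap.ker (X.coprod Y) : Submodule F (U × U)) =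
      2 * finrank F A := by
  have h := LinearMap.finrank_range_add_finrank_ker ((X.coprod Y).domRestrict (A.prod A))
  rw [LinearMap.range_domRestrict, LinearMap.coprod_map_prod, LinearMap.ker_domRestrict,
    finrank_prod_submodule] at h
  rw [← h, ← Submodule.map_comap_subtype, Submodule.finrank_map_subtype_eq]

/-- If `(d, e) ↦ d.1 + e.2` is injective on `K × K`, the span of the coordinates of a subspace
`S ≤ K` has dimension `2 dim S`. -/
theorem finrank_map_fst_sup_map_snd [FiniteDimensional F U] (S : Submodule F (U × U))
    (h : ∀ d ∈ S, ∀ e ∈ S, d.1 + e.2 = 0 → d = 0 ∧ e = 0) :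
    finrank F (S.map (LinearMap.fst F U U) ⊔ S.map (LinearMap.snd F U U) : Submodule F U) =
      2 * finrank F S := by
  have h1 : LinearMap.range (((LinearMap.fst F U U).comp S.subtype).coprod
      ((LinearMap.snd F U U).comp S.subtype)) =
      S.map (LinearMap.fst F U U) ⊔ S.map (LinearMap.snd F U U) := by
    rw [LinearMap.range_coprod, LinearMap.range_comp, LinearMap.range_comp,
      Submodule.range_subtype]
  rw [← h1, LinearMap.finrank_range_of_inj, finrank_prod, two_mul]
  rw [← LinearMap.ker_eq_bot, LinearMap.ker_eq_bot']
  rintro ⟨d, e⟩ hde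
  obtain ⟨h2, h3⟩ := h d d.2 e e.2 hde
  exact Prod.ext (Subtype.ext h2) (Subtype.ext h3)

/-- The pairs `(A, B)` of subspaces of given dimensions with `X A + Y A ≤ B`. -/
abbrev PencilPair (X Y : U →ₗ[F] W) (a b : ℕ) : Type _ :=
  {P : Submodule F U × Submodule F W //
    (P.1.map X ≤ P.2 ∧ P.1.map Y ≤ P.2) ∧ finrank F P.1 = a ∧ finrank F P.2 = b}

/-- Pairs `(A, B)` as choices of `A` followed by `B ≥ X A + Y A`. -/
def pencilPairEquiv (X Y : U →ₗ[F] W) (a b : ℕ) :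
    PencilPair X Y a b ≃ Σ A : {A : Submodule F U // finrank F A = a},
      {B : Submodule F W // A.1.map X ⊔ A.1.map Y ≤ B ∧ finrank F B = b} where
  toFun P := ⟨⟨P.1.1, P.2.2.1⟩, ⟨P.1.2, sup_le P.2.1.1 P.2.1.2, P.2.2.2⟩⟩
  invFun Q := ⟨(Q.1.1, Q.2.1), ⟨le_sup_left.trans Q.2.2.1, le_sup_right.trans Q.2.2.1⟩,
    Q.1.2, Q.2.2.2⟩
  left_inv _ := rfl
  right_inv _ := rfl

/-- Double counting of the pairs `(A, S)` with `S ≤ (A × A) ∩ K`. -/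
def kernelPairEquiv (K : Submodule F (U × U)) (a i : ℕ) :
    (Σ A : {A : Submodule F U // finrank F A = a},
      {S : Submodule F (U × U) // S ≤ A.1.prod A.1 ⊓ K ∧ finrank F S = i}) ≃
    Σ S : {S : Submodule F (U × U) // S ≤ K ∧ finrank F S = i},
      {A : Submodule F U // S.1.map (LinearMap.fst F U U) ⊔ S.1.map (LinearMap.snd F U U) ≤ A ∧
        finrank F A = a} where
  toFun P := ⟨⟨P.2.1, P.2.2.1.trans inf_le_right, P.2.2.2⟩, ⟨P.1.1, by
    have h := P.2.2.1.trans inf_le_left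
    exact sup_le (Submodule.map_le_iff_le_comap.2 fun x hx => (h hx).1)
      (Submodule.map_le_iff_le_comap.2 fun x hx => (h hx).2), P.1.2⟩⟩
  invFun Q := ⟨⟨Q.2.1, Q.2.2.2⟩, ⟨Q.1.1, le_inf (fun x hx =>
    ⟨(le_sup_left.trans Q.2.2.1) (Submodule.mem_map_of_mem hx),
      (le_sup_right.trans Q.2.2.1) (Submodule.mem_map_of_mem hx)⟩) Q.1.2.1, Q.1.2.2⟩⟩
  left_inv _ := rfl
  right_inv _ := rfl

end Pencil

/-- The number of pairs `(A, B)` for a pencil with onto `X + Y` whose kernel `K` has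
`K × K → U, (d, e) ↦ d.1 + e.2` injective is a polynomial in the size of the field that
depends only on dimensions. -/
theorem exists_polynomial_card_pencilPair (n w a b : ℕ) : ∃ P : Polynomial ℤ,
    ∀ (F U W : Type) [Field F] [Fintype F] [AddCommGroup U] [Module F U] [Finite U]
      [AddCommGroup W] [Module F W] [Finite W] (X Y : U →ₗ[F] W),
      finrank F U = n → finrank F W = w → LinearMap.range X ⊔ LinearMap.range Y = ⊤ →
      (∀ d e : U × U, X d.1 + Y d.2 = 0 → X e.1 + Y e.2 = 0 → d.1 + e.2 = 0 → d = 0 ∧ e = 0) →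
      (Nat.card (PencilPair X Y a b) : ℤ) = P.eval (Fintype.card F : ℤ) := by
  -- `dim (X A + Y A) = 2 * a - m` for `m = dim ((A × A) ∩ K)`, and `dim K = 2 * n - w`; none of
  -- these subtractions truncates when a pencil with the given dimensions exists
  let g := gaussInverse fun m =>
    if 2 * a - m ≤ b then gaussBinom (w - (2 * a - m)) (b - (2 * a - m)) else 0
  refine ⟨∑ i ∈ Finset.range (2 * n - w + 1), gaussBinom (2 * n - w) i *
    (if 2 * i ≤ a then gaussBinom (n - 2 * i) (a - 2 * i) else 0) * g i, ?_⟩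
  intro F U W _ _ _ _ _ _ _ _ X Y hn hw hsurj hinj
  have : Finite (Submodule F U) := Finite.of_injective _ SetLike.coe_injective
  have : Finite (Submodule F W) := Finite.of_injective _ SetLike.coe_injective
  have : Finite (Submodule F (U × U)) := Finite.of_injective _ SetLike.coe_injective
  let _ : Fintype {A : Submodule F U // finrank F A = a} := Fintype.ofFinite _
  set q : ℤ := (Fintype.card F : ℤ) with hq
  set K := LinearMap.ker (X.coprod Y) with hK
  have hdimK : finrank F K = 2 * n - w := by
    have h := LinearMap.finrank_range_add_finrank_ker (X.coprod Y)
    rw [LinearMap.range_coprod, hsurj, finrank_top, hw, finrank_prod, hn, ← hK] at h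
    omega
  -- the fibre over `A` depends only on `dim (A × A ∩ K)`, and Gaussian inversion makes it a sum
  -- over the subspaces of `A × A ∩ K`
  have hfib : ∀ A : {A : Submodule F U // finrank F A = a},
      (Nat.card {B : Submodule F W // A.1.map X ⊔ A.1.map Y ≤ B ∧ finrank F B = b} : ℤ) =
      ∑ i ∈ Finset.range (2 * n - w + 1),
        (Nat.card {S : Submodule F (U × U) // S ≤ A.1.prod A.1 ⊓ K ∧ finrank F S = i} : ℤ) *
          (g i).eval q := by
    intro A
    have h1 := finrank_map_sup_map_add_finrank X Y A.1
    rw [A.2, ← hK] at h1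
    set m := finrank F (A.1.prod A.1 ⊓ K : Submodule F (U × U)) with hm
    have h2 : finrank F (A.1.map X ⊔ A.1.map Y : Submodule F W) = 2 * a - m := by omega
    have hmK : m ≤ 2 * n - w := hdimK ▸ Submodule.finrank_mono inf_le_right
    have h3 := congrArg (Polynomial.eval q) (sum_gaussBinom_mul_gaussInverse
      (fun m => if 2 * a - m ≤ b then gaussBinom (w - (2 * a - m)) (b - (2 * a - m)) else 0)
      m).symm
    rw [card_submodule_ge_finrank_eq, h2, hw]
    simp only [card_submodule_le_finrank_eq, ← hm, ← hq]
    rw [apply_ite (Polynomial.eval q), Polynomial.eval_zero, Polynomial.eval_finsetSum] at h3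
    rw [h3]
    simp only [Polynomial.eval_mul]
    refine Finset.sum_subset (Finset.range_subset_range.2 (by omega)) fun i _ hi => ?_
    rw [gaussBinom_eq_zero (by simpa using hi)]
    simp
  have hswap : ∀ i, ∑ A : {A : Submodule F U // finrank F A = a},
      (Nat.card {S : Submodule F (U × U) // S ≤ A.1.prod A.1 ⊓ K ∧ finrank F S = i} : ℤ) =
      (gaussBinom (2 * n - w) i * (if 2 * i ≤ a then gaussBinom (n - 2 * i) (a - 2 * i)
        else 0)).eval q := by
    intro i
    let _ : Fintype {S : Submodule F (U × U) // S ≤ K ∧ finrank F S = i} := Fintype.ofFinite _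
    rw [← Nat.cast_sum, ← Nat.card_sigma, Nat.card_congr (kernelPairEquiv K a i), Nat.card_sigma,
      Nat.cast_sum]
    have h4 : ∀ S : {S : Submodule F (U × U) // S ≤ K ∧ finrank F S = i},
        (Nat.card {A : Submodule F U // S.1.map (LinearMap.fst F U U) ⊔
          S.1.map (LinearMap.snd F U U) ≤ A ∧ finrank F A = a} : ℤ) =
        (if 2 * i ≤ a then gaussBinom (n - 2 * i) (a - 2 * i) else 0).eval q := by
      intro S
      rw [card_submodule_ge_finrank_eq, finrank_map_fst_sup_map_snd S.1
        (fun d hd e he => hinj d e (S.2.1 hd) (S.2.1 he)), S.2.2, hn,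
        apply_ite (Polynomial.eval q), Polynomial.eval_zero]
    rw [Finset.sum_congr rfl fun S _ => h4 S, Finset.sum_const, Finset.card_univ,
      ← Nat.card_eq_fintype_card, nsmul_eq_mul, card_submodule_le_finrank_eq, hdimK,
      Polynomial.eval_mul]
  rw [Nat.card_congr (pencilPairEquiv X Y a b), Nat.card_sigma, Nat.cast_sum,
    Finset.sum_congr rfl fun A _ => hfib A, Finset.sum_comm, Polynomial.eval_finsetSum]
  refine Finset.sum_congr rfl fun i _ => ?_
  rw [← Finset.sum_mul, hswap, ← Polynomial.eval_mul]

/-- The same for a pencil in which every nonzero `A` has `X A + Y A = W`. -/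
theorem exists_polynomial_card_pencilPair_of_forall_ne_bot (n w a b : ℕ) : ∃ P : Polynomial ℤ,
    ∀ (F U W : Type) [Field F] [Fintype F] [AddCommGroup U] [Module F U] [Finite U]
      [AddCommGroup W] [Module F W] [Finite W] (X Y : U →ₗ[F] W),
      finrank F U = n → finrank F W = w →
      (∀ A : Submodule F U, A ≠ ⊥ → A.map X ⊔ A.map Y = ⊤) →
      (Nat.card (PencilPair X Y a b) : ℤ) = P.eval (Fintype.card F : ℤ) := by
  refine ⟨gaussBinom n a * if a = 0 then gaussBinom w b else if w ≤ b then
    gaussBinom (w - w) (b - w) else 0, ?_⟩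
  intro F U W _ _ _ _ _ _ _ _ X Y hn hw hA
  have : Finite (Submodule F U) := Finite.of_injective _ SetLike.coe_injective
  have : Finite (Submodule F W) := Finite.of_injective _ SetLike.coe_injective
  let _ : Fintype {A : Submodule F U // finrank F A = a} := Fintype.ofFinite _
  have h : ∀ A : {A : Submodule F U // finrank F A = a},
      (Nat.card {B : Submodule F W // A.1.map X ⊔ A.1.map Y ≤ B ∧ finrank F B = b} : ℤ) =
      (if a = 0 then gaussBinom w b else if w ≤ b then
        gaussBinom (w - w) (b - w) else 0).eval (Fintype.card F : ℤ) := by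
    rintro ⟨A, rfl⟩
    rw [card_submodule_ge_finrank_eq]
    by_cases h0 : finrank F A = 0
    · rw [if_pos h0, Submodule.finrank_eq_zero.1 h0]
      rw [Submodule.map_bot, Submodule.map_bot, sup_bot_eq, finrank_bot]
      simp [hw]
    · rw [if_neg h0, hA A fun h => h0 (h ▸ finrank_bot F U), finrank_top, hw,
        apply_ite (Polynomial.eval _), Polynomial.eval_zero]
  rw [Nat.card_congr (pencilPairEquiv X Y a b), Nat.card_sigma, Nat.cast_sum,
    Finset.sum_congr rfl fun A _ => h A, Finset.sum_const, Finset.card_univ,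
    ← Nat.card_eq_fintype_card, nsmul_eq_mul, card_submodule_finrank_eq, hn, Polynomial.eval_mul]

namespace FreeLieAlgebra

open MonoidAlgebra (single)

attribute [local instance] LieRing.ofAssociativeRing

variable (R : Type*) [CommRing R] {X : Type*}

/-- A Lie subalgebra containing the generators is everything. -/
theorem lieSubalgebra_eq_top {K : LieSubalgebra R (FreeLieAlgebra R X)}
    (hK : ∀ i, of R i ∈ K) (z : FreeLieAlgebra R X) : z ∈ K := by
  have h : K.incl.comp (lift R fun i => (⟨_, hK i⟩ : K)) = LieHom.id := by
    ext i
    simp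
  have hz : ((lift R (fun i => (⟨_, hK i⟩ : K)) z : K) : FreeLieAlgebra R X) = z :=
    congrArg (fun f : FreeLieAlgebra R X →ₗ⁅R⁆ FreeLieAlgebra R X => f z) h
  rw [← hz]
  exact (lift R (fun i => (⟨_, hK i⟩ : K)) z).2

/-! ### Right-normed brackets -/

/-- The right-normed bracket `⁅x₁, ⁅x₂, … ⁅xₙ₋₁, xₙ⁆⁆⁆` of a word; that of the empty word is `0`. -/
def bracket : List X → FreeLieAlgebra R X
  | [] => 0
  | [i] => of R i
  | i :: j :: m => ⁅of R i, bracket (j :: m)⁆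

@[simp] theorem bracket_nil : bracket R ([] : List X) = 0 := rfl

@[simp] theorem bracket_singleton (i : X) : bracket R [i] = of R i := rfl

theorem bracket_cons (i : X) {m : List X} (hm : m ≠ []) :
    bracket R (i :: m) = ⁅of R i, bracket R m⁆ := by
  cases m with
  | nil => exact absurd rfl hm
  | cons j m => rfl

/-- The span of the right-normed brackets of words whose length lies in `S`. -/
def bracketSpan (S : Set ℕ) : Submodule R (FreeLieAlgebra R X) :=
  Submodule.span R (bracket R '' {m | m.length ∈ S})

/-- The component of weight `n`, as the span of the right-normed brackets of weight `n`. -/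
abbrev weight (n : ℕ) : Submodule R (FreeLieAlgebra R X) := bracketSpan R {n}

variable {R}

theorem bracket_mem {S : Set ℕ} {m : List X} (h : m.length ∈ S) : bracket R m ∈ bracketSpan R S :=
  Submodule.subset_span ⟨m, h, rfl⟩

theorem bracketSpan_mono {S T : Set ℕ} (h : S ⊆ T) :
    (bracketSpan R S : Submodule R (FreeLieAlgebra R X)) ≤ bracketSpan R T :=
  Submodule.span_mono (Set.image_mono fun _ hm => h hm)

theorem lie_of_mem_weight (i : X) {n : ℕ} {z : FreeLieAlgebra R X} (hz : z ∈ weight R n) :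
    ⁅of R i, z⁆ ∈ weight R (n + 1) := by
  induction hz using Submodule.span_induction with
  | mem z hz =>
    obtain ⟨m, hm, rfl⟩ := hz
    rcases eq_or_ne m [] with rfl | h
    · simp
    · rw [← bracket_cons R i h]
      exact bracket_mem (by simpa using hm)
  | zero => simp
  | add z w _ _ hz hw => rw [lie_add]; exact add_mem hz hw
  | smul t z _ hz => rw [lie_smul]; exact Submodule.smul_mem _ t hz

theorem bracket_lie_mem_weight (m : List X) {n : ℕ} {z : FreeLieAlgebra R X}
    (hz : z ∈ weight R n) : ⁅bracket R m, z⁆ ∈ weight R (m.length + n) := by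
  induction m generalizing n z with
  | nil => simp
  | cons i m ih =>
    rcases eq_or_ne m [] with rfl | h
    · rw [bracket_singleton, List.length_singleton, add_comm]
      exact lie_of_mem_weight i hz
    · rw [bracket_cons R i h, lie_lie, List.length_cons]
      refine sub_mem ?_ ?_
      · rw [add_right_comm]
        exact lie_of_mem_weight i (ih hz)
      · rw [add_right_comm, add_assoc]
        exact ih (lie_of_mem_weight i hz)

theorem lie_mem_bracketSpan {S T V : Set ℕ} (h : ∀ a ∈ S, ∀ b ∈ T, a + b ∈ V)
    {y z : FreeLieAlgebra R X} (hy : y ∈ bracketSpan R S) (hz : z ∈ bracketSpan R T) :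
    ⁅y, z⁆ ∈ bracketSpan R V := by
  induction hy, hz using Submodule.span_induction₂ with
  | mem_mem y z hy hz =>
    obtain ⟨m, hm, rfl⟩ := hy
    obtain ⟨m', hm', rfl⟩ := hz
    refine bracketSpan_mono ?_ (bracket_lie_mem_weight m (bracket_mem (Set.mem_singleton _)))
    simpa using h _ hm _ hm'
  | zero_left z _ => simp
  | zero_right y _ => simp
  | add_left x y z _ _ _ h1 h2 => rw [add_lie]; exact add_mem h1 h2
  | add_right x y z _ _ _ h1 h2 => rw [lie_add]; exact add_mem h1 h2
  | smul_left t y z _ _ h => rw [smul_lie]; exact Submodule.smul_mem _ t h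
  | smul_right t y z _ _ h => rw [lie_smul]; exact Submodule.smul_mem _ t h

theorem mem_bracketSpan_pos (z : FreeLieAlgebra R X) : z ∈ bracketSpan R (Set.Ioi 0) :=
  lieSubalgebra_eq_top R
    (K := { (bracketSpan R (Set.Ioi 0) : Submodule R (FreeLieAlgebra R X)) with
      lie_mem' := lie_mem_bracketSpan fun a ha b hb => by
        simp only [Set.mem_Ioi] at *; omega })
    (fun i => (bracket_mem (m := [i]) (by simp) : bracket R [i] ∈ bracketSpan R (Set.Ioi 0))) z

theorem lowerCentralSeries_le_bracketSpan (c : ℕ) :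
    (LieModule.lowerCentralSeries R (FreeLieAlgebra R X) (FreeLieAlgebra R X) c).toSubmodule ≤
      bracketSpan R (Set.Ioi c) := by
  induction c with
  | zero => exact fun z _ => mem_bracketSpan_pos z
  | succ c ih =>
    rw [LieModule.lowerCentralSeries_succ, LieSubmodule.lieIdeal_oper_eq_linear_span',
      Submodule.span_le]
    rintro _ ⟨y, -, z, hz, rfl⟩
    refine lie_mem_bracketSpan (fun a ha b hb => ?_) (mem_bracketSpan_pos y) (ih hz)
    simp only [Set.mem_Ioi] at *; omega

theorem bracket_mem_lowerCentralSeries (m : List X) :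
    bracket R m ∈ LieModule.lowerCentralSeries R (FreeLieAlgebra R X) (FreeLieAlgebra R X)
      (m.length - 1) := by
  induction m with
  | nil => simp
  | cons i m ih =>
    rcases eq_or_ne m [] with rfl | h
    · simp
    · have := List.length_pos_iff.2 h
      rw [bracket_cons R i h, List.length_cons, Nat.add_sub_cancel,
        ← Nat.sub_add_cancel (Nat.succ_le_of_lt this), LieModule.lowerCentralSeries_succ]
      exact LieSubmodule.lie_mem_lie (LieSubmodule.mem_top _) ih

/-! ### The free associative algebra -/

variable (R) in
/-- The canonical map to the free associative algebra, the monoid algebra of words. -/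
def assoc : FreeLieAlgebra R X →ₗ⁅R⁆ MonoidAlgebra R (FreeMonoid X) :=
  lift R fun i => single (FreeMonoid.of i) 1

@[simp] theorem assoc_of (i : X) : assoc R (of R i) = single (FreeMonoid.of i) 1 := by
  simp [assoc]

theorem assoc_lie (y z : FreeLieAlgebra R X) :
    assoc R ⁅y, z⁆ = assoc R y * assoc R z - assoc R z * assoc R y := by
  rw [LieHom.map_lie, LieRing.of_associative_ring_bracket]

/-- The coefficient of the word `m` in `a`, with words given as lists. -/
def wc (a : MonoidAlgebra R (FreeMonoid X)) (m : List X) : R := a.coeff (FreeMonoid.ofList m)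

@[simp] theorem wc_zero (m : List X) : wc (0 : MonoidAlgebra R (FreeMonoid X)) m = 0 := rfl

@[simp] theorem wc_add (a b : MonoidAlgebra R (FreeMonoid X)) (m : List X) :
    wc (a + b) m = wc a m + wc b m := rfl

@[simp] theorem wc_sub (a b : MonoidAlgebra R (FreeMonoid X)) (m : List X) :
    wc (a - b) m = wc a m - wc b m := rfl

@[simp] theorem wc_smul (t : R) (a : MonoidAlgebra R (FreeMonoid X)) (m : List X) :
    wc (t • a) m = t * wc a m := rfl

theorem wc_sum {ι : Type*} (s : Finset ι) (f : ι → MonoidAlgebra R (FreeMonoid X)) (m : List X) :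
    wc (∑ i ∈ s, f i) m = ∑ i ∈ s, wc (f i) m := by
  simp [wc, Finsupp.finsetSum_apply]

theorem wc_single_self (m : List X) (r : R) : wc (single (FreeMonoid.ofList m) r) m = r :=
  Finsupp.single_eq_same

theorem wc_single_of_ne {m w : List X} (h : w ≠ m) (r : R) :
    wc (single (FreeMonoid.ofList m) r) w = 0 :=
  Finsupp.single_eq_of_ne h

theorem wc_of_mul_cons (i : X) (a : MonoidAlgebra R (FreeMonoid X)) (m : List X) :
    wc (single (FreeMonoid.of i) 1 * a) (i :: m) = wc a m := by
  rw [wc, MonoidAlgebra.coeff_single_mul_eq_mul_coeff (FreeMonoid.ofList m), one_mul, wc]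
  intro m' _
  rw [FreeMonoid.ofList_cons]
  exact mul_right_inj _

theorem wc_of_mul_cons_ne {i j : X} (h : i ≠ j) (a : MonoidAlgebra R (FreeMonoid X))
    (m : List X) : wc (single (FreeMonoid.of i) 1 * a) (j :: m) = 0 := by
  refine MonoidAlgebra.coeff_single_mul_of_forall_mul_ne _ _ fun d hd => h ?_
  exact (List.cons.inj (congrArg FreeMonoid.toList hd)).1

theorem wc_of_mul_nil (i : X) (a : MonoidAlgebra R (FreeMonoid X)) :
    wc (single (FreeMonoid.of i) 1 * a) [] = 0 := by
  refine MonoidAlgebra.coeff_single_mul_of_forall_mul_ne _ _ fun d hd => ?_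
  exact List.cons_ne_nil _ _ (congrArg FreeMonoid.toList hd)

theorem wc_mul_of_concat (i : X) (a : MonoidAlgebra R (FreeMonoid X)) (m : List X) :
    wc (a * single (FreeMonoid.of i) 1) (m ++ [i]) = wc a m := by
  rw [wc, MonoidAlgebra.coeff_mul_single_eq_coeff_mul (FreeMonoid.ofList m), mul_one, wc]
  intro m' _
  rw [FreeMonoid.ofList_append, FreeMonoid.ofList_singleton]
  exact mul_left_inj _

theorem wc_mul_of_concat_ne {i j : X} (h : i ≠ j) (a : MonoidAlgebra R (FreeMonoid X))
    (m : List X) : wc (a * single (FreeMonoid.of i) 1) (m ++ [j]) = 0 := by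
  refine MonoidAlgebra.coeff_mul_single_of_forall_mul_ne _ _ fun d hd => h ?_
  have h1 : FreeMonoid.toList d ++ [i] = m ++ [j] := congrArg FreeMonoid.toList hd
  simpa using (List.append_inj' h1 rfl).2

theorem wc_mul_of_nil (i : X) (a : MonoidAlgebra R (FreeMonoid X)) :
    wc (a * single (FreeMonoid.of i) 1) [] = 0 := by
  refine MonoidAlgebra.coeff_mul_single_of_forall_mul_ne _ _ fun d hd => ?_
  have h1 : FreeMonoid.toList d ++ [i] = [] := congrArg FreeMonoid.toList hd
  simp at h1

theorem wc_assoc_bracket (m w : List X) (h : w.length ≠ m.length) :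
    wc (assoc R (bracket R m)) w = 0 := by
  induction m generalizing w with
  | nil => simp
  | cons i m ih =>
    rcases eq_or_ne m [] with rfl | hm
    · rw [bracket_singleton, assoc_of]
      exact wc_single_of_ne (m := [i]) (fun h' => h (congrArg List.length h')) 1
    · rw [bracket_cons R i hm, assoc_lie, assoc_of, wc_sub, sub_eq_zero]
      trans 0
      · cases w with
        | nil => exact wc_of_mul_nil _ _
        | cons j w =>
          rcases eq_or_ne i j with rfl | hij
          · rw [wc_of_mul_cons, ih]; simpa using h
          · exact wc_of_mul_cons_ne hij _ _
      · symm
        rcases List.eq_nil_or_concat w with rfl | ⟨w, j, rfl⟩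
        · exact wc_mul_of_nil _ _
        · rw [List.concat_eq_append] at h ⊢
          rcases eq_or_ne i j with rfl | hij
          · rw [wc_mul_of_concat, ih]; simpa using h
          · exact wc_mul_of_concat_ne hij _ _

theorem wc_assoc_eq_zero {S : Set ℕ} {z : FreeLieAlgebra R X} (hz : z ∈ bracketSpan R S)
    {w : List X} (h : w.length ∉ S) : wc (assoc R z) w = 0 := by
  induction hz using Submodule.span_induction with
  | mem z hz =>
    obtain ⟨m, hm, rfl⟩ := hz
    exact wc_assoc_bracket m w fun h' => h (h' ▸ hm)
  | zero => simp
  | add z w _ _ hz hw => rw [map_add, wc_add, hz, hw, add_zero]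
  | smul t z _ hz => rw [map_smul, wc_smul, hz, mul_zero]

/-! ### The Dynkin operator -/

variable (R X) in
/-- The adjoint action, extended to the free associative algebra. -/
def adAction : MonoidAlgebra R (FreeMonoid X) →ₐ[R] Module.End R (FreeLieAlgebra R X) :=
  MonoidAlgebra.lift R _ _ (FreeMonoid.lift fun i => LieAlgebra.ad R (FreeLieAlgebra R X) (of R i))

theorem adAction_assoc (z : FreeLieAlgebra R X) :
    adAction R X (assoc R z) = LieAlgebra.ad R (FreeLieAlgebra R X) z := by
  have h : ((adAction R X : MonoidAlgebra R (FreeMonoid X) →ₗ⁅R⁆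
      Module.End R (FreeLieAlgebra R X)).comp (assoc R)) = LieAlgebra.ad R _ := by
    ext1 i
    simp [adAction]
  exact congrArg (fun f : FreeLieAlgebra R X →ₗ⁅R⁆ Module.End R (FreeLieAlgebra R X) => f z) h

variable (R X) in
/-- The Dynkin operator, sending a word to its right-normed bracket. -/
def dynkin : MonoidAlgebra R (FreeMonoid X) →ₗ[R] FreeLieAlgebra R X :=
  (Finsupp.linearCombination R fun m : FreeMonoid X => bracket R m.toList) ∘ₗ
    (MonoidAlgebra.coeffLinearEquiv R).toLinearMap

theorem dynkin_apply (a : MonoidAlgebra R (FreeMonoid X)) :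
    dynkin R X a = a.coeff.sum fun m r => r • bracket R m.toList := rfl

@[simp] theorem dynkin_single (m : FreeMonoid X) (r : R) :
    dynkin R X (single m r) = r • bracket R m.toList := by
  simp [dynkin_apply]

theorem dynkin_of_mul (i : X) (a : MonoidAlgebra R (FreeMonoid X)) :
    dynkin R X (single (FreeMonoid.of i) 1 * a) =
      ⁅of R i, dynkin R X a⁆ + wc a [] • of R i := by
  induction a using MonoidAlgebra.induction_linear with
  | zero => simp
  | add a b ha hb =>
    rw [mul_add, map_add, map_add, ha, hb, lie_add, wc_add, add_smul]
    abel
  | single m r =>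
    rw [MonoidAlgebra.single_mul_single, one_mul, dynkin_single, dynkin_single]
    cases m using FreeMonoid.casesOn with
    | one =>
      rw [← FreeMonoid.ofList_nil, wc_single_self]
      simp
    | of_mul j m =>
      have h : wc (single (FreeMonoid.of j * m) r) [] = 0 :=
        wc_single_of_ne (m := j :: m.toList) (List.cons_ne_nil _ _).symm r
      rw [h, zero_smul, add_zero, lie_smul]
      rfl

theorem dynkin_mul (a b : MonoidAlgebra R (FreeMonoid X)) (hb : wc b [] = 0) :
    dynkin R X (a * b) = adAction R X a (dynkin R X b) := by
  induction a using MonoidAlgebra.induction_linear with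
  | zero => simp
  | add a a' ha ha' => rw [add_mul, map_add, map_add, ha, ha', LinearMap.add_apply]
  | single m r =>
    have h : ∀ m : FreeMonoid X, dynkin R X (single m 1 * b) =
        adAction R X (single m 1) (dynkin R X b) ∧ wc (single m 1 * b) [] = 0 := by
      intro m
      induction m using FreeMonoid.inductionOn' with
      | one => rw [← MonoidAlgebra.one_def, one_mul, map_one]; exact ⟨rfl, hb⟩
      | of_mul i m ih =>
        have h1 : (single (FreeMonoid.of i * m) 1 : MonoidAlgebra R (FreeMonoid X)) =
            single (FreeMonoid.of i) 1 * single m 1 := by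
          rw [MonoidAlgebra.single_mul_single, one_mul]
        rw [h1, mul_assoc]
        refine ⟨?_, wc_of_mul_nil _ _⟩
        rw [dynkin_of_mul, ih.2, zero_smul, add_zero, ih.1, map_mul, Module.End.mul_apply]
        simp [adAction]
    have h2 : (single m r : MonoidAlgebra R (FreeMonoid X)) = r • single m 1 := by
      rw [MonoidAlgebra.smul_single, smul_eq_mul, mul_one]
    rw [h2, smul_mul_assoc, map_smul, map_smul, (h m).1, LinearMap.smul_apply]

/-- On elements of weight `n`, the Dynkin operator is multiplication by `n`. -/
theorem dynkin_assoc {n : ℕ} {z : FreeLieAlgebra R X} (hz : z ∈ weight R n) :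
    dynkin R X (assoc R z) = n • z := by
  induction hz using Submodule.span_induction with
  | mem z hz =>
    obtain ⟨m, hm, rfl⟩ := hz
    rw [← (hm : m.length = n)]
    clear hm
    induction m with
    | nil => simp
    | cons i m ih =>
      rcases eq_or_ne m [] with rfl | hm
      · simp
      · have h1 : wc (assoc R (bracket R m)) [] = 0 :=
          wc_assoc_bracket _ _ (by simpa [eq_comm] using hm)
        have h2 : wc (assoc R (of R i)) [] = 0 :=
          wc_assoc_bracket [i] [] (by simp)
        rw [bracket_cons R i hm, assoc_lie, map_sub, dynkin_mul _ _ h1, dynkin_mul _ _ h2,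
          adAction_assoc, adAction_assoc, ih, List.length_cons]
        simp only [LieAlgebra.ad_apply, assoc_of, dynkin_single, one_smul]
        rw [FreeMonoid.toList_of, bracket_singleton, lie_nsmul, ← lie_skew (bracket R m),
          sub_neg_eq_add, add_smul, one_smul]
  | zero => simp
  | add z w _ _ hz hw => rw [map_add, map_add, hz, hw, smul_add]
  | smul t z _ hz => rw [map_smul, map_smul, hz, smul_comm]

/-! ### Vanishing criteria -/

/-- Interchange of the last two letters of a word. -/
def swapLast : List X → List X
  | [] => []
  | [i] => [i]
  | [i, j] => [j, i]
  | i :: j :: k :: m => i :: swapLast (j :: k :: m)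

theorem swapLast_append (p : List X) (i j : X) : swapLast (p ++ [i, j]) = p ++ [j, i] := by
  induction p with
  | nil => rfl
  | cons x p ih =>
    rcases p with _ | ⟨y, _ | ⟨z, p⟩⟩
    · rfl
    · rfl
    · rw [List.cons_append, List.cons_append, List.cons_append, swapLast]
      exact congrArg _ ih

theorem exists_eq_append_pair {m : List X} (h : 2 ≤ m.length) : ∃ p i j, m = p ++ [i, j] := by
  rcases List.eq_nil_or_concat m with rfl | ⟨m, j, rfl⟩
  · simp at h
  rcases List.eq_nil_or_concat m with rfl | ⟨p, i, rfl⟩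
  · simp at h
  exact ⟨p, i, j, by simp⟩

theorem bracket_append_swap (p : List X) (i j : X) :
    bracket R (p ++ [j, i]) = -bracket R (p ++ [i, j]) := by
  induction p with
  | nil => exact (lie_skew _ _).symm
  | cons x p ih =>
    rw [List.cons_append, List.cons_append, bracket_cons R x (by simp), bracket_cons R x (by simp),
      ih, lie_neg]

theorem bracket_append_same (p : List X) (i : X) : bracket R (p ++ [i, i]) = 0 := by
  induction p with
  | nil => exact lie_self _
  | cons x p ih => rw [List.cons_append, bracket_cons R x (by simp), ih, lie_zero]

/-- The Dynkin operator kills the elements whose coefficients are symmetric in the last two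
letters. -/
theorem dynkin_eq_zero_of_swap {a : MonoidAlgebra R (FreeMonoid X)}
    (h : ∀ p i j, wc a (p ++ [i, j]) = wc a (p ++ [j, i]))
    (h' : ∀ m : List X, m.length < 2 → wc a m = 0) : dynkin R X a = 0 := by
  have key : ∀ m ∈ a.coeff.support, ∃ p i j, m = FreeMonoid.ofList (p ++ [i, j]) := by
    intro m hm
    refine exists_eq_append_pair (not_lt.1 fun hlt => Finsupp.mem_support_iff.1 hm (h' _ hlt))
  rw [dynkin_apply, Finsupp.sum]
  refine Finset.sum_involution (fun m _ => FreeMonoid.ofList (swapLast m.toList)) ?_ ?_ ?_ ?_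
  · intro m hm
    obtain ⟨p, i, j, rfl⟩ := key m hm
    simp only [FreeMonoid.toList_ofList, swapLast_append]
    have := h p i j
    rw [wc, wc] at this
    rw [bracket_append_swap p i j, this, smul_neg, add_neg_cancel]
  · intro m hm hne heq
    obtain ⟨p, i, j, rfl⟩ := key m hm
    simp only [FreeMonoid.toList_ofList, swapLast_append] at hne heq
    have h1 : p ++ [j, i] = p ++ [i, j] := heq
    simp only [List.append_cancel_left_eq, List.cons.injEq, and_true] at h1
    rw [h1.1, bracket_append_same, smul_zero] at hne
    exact hne rfl
  · intro m hm
    obtain ⟨p, i, j, rfl⟩ := key m hm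
    simp only [FreeMonoid.toList_ofList, swapLast_append, Finsupp.mem_support_iff] at hm ⊢
    exact fun h0 => hm ((h p i j).trans h0)
  · intro m hm
    obtain ⟨p, i, j, rfl⟩ := key m hm
    simp only [FreeMonoid.toList_ofList, swapLast_append]

theorem eq_zero_of_dynkin_eq_zero {n : ℕ} (hn : IsUnit (n : R)) {z : FreeLieAlgebra R X}
    (hz : z ∈ weight R n) (h : dynkin R X (assoc R z) = 0) : z = 0 := by
  rw [dynkin_assoc hz, ← Nat.cast_smul_eq_nsmul R] at h
  exact (hn.smul_eq_zero).1 h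

theorem eq_zero_of_swap {n : ℕ} (h2 : 2 ≤ n) (hn : IsUnit (n : R)) {z : FreeLieAlgebra R X}
    (hz : z ∈ weight R n)
    (h : ∀ p i j, wc (assoc R z) (p ++ [i, j]) = wc (assoc R z) (p ++ [j, i])) : z = 0 :=
  eq_zero_of_dynkin_eq_zero hn hz (dynkin_eq_zero_of_swap h fun m hm =>
    wc_assoc_eq_zero hz (by simp only [Set.mem_singleton_iff]; omega))

/-- A generator has no centralizer in weight at least `2`. -/
theorem eq_zero_of_lie_of_eq_zero {n : ℕ} (h2 : 2 ≤ n) (hn : IsUnit (n : R))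
    {z : FreeLieAlgebra R X} (hz : z ∈ weight R n) (y : X) (h : ⁅of R y, z⁆ = 0) : z = 0 := by
  have hc : ∀ m, wc (single (FreeMonoid.of y) 1 * assoc R z) m =
      wc (assoc R z * single (FreeMonoid.of y) 1) m := by
    have := congrArg (assoc R) h
    rw [assoc_lie, assoc_of, map_zero, sub_eq_zero] at this
    exact fun m => by rw [this]
  have h1 : ∀ (m : List X) (b : X), b ≠ y → wc (assoc R z) (m ++ [b]) = 0 := by
    intro m b hb
    rw [← wc_of_mul_cons y, hc, ← List.cons_append, wc_mul_of_concat_ne hb.symm]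
  have h3 : ∀ (p : List X) (a b : X), a ≠ b → wc (assoc R z) (p ++ [a, b]) = 0 := by
    intro p a b hab
    rw [show p ++ [a, b] = (p ++ [a]) ++ [b] by simp]
    rcases eq_or_ne b y with rfl | hb
    · rw [← wc_of_mul_cons b, hc, ← List.cons_append, wc_mul_of_concat, ← List.cons_append,
        h1 _ _ hab]
    · exact h1 _ _ hb
  refine eq_zero_of_swap h2 hn hz fun p i j => ?_
  rcases eq_or_ne i j with rfl | hij
  · rfl
  · rw [h3 p i j hij, h3 p j i hij.symm]

theorem append_comm_of_cons_eq_concat {α : Type*} {Φ : List X → α}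
    (h : ∀ l m, Φ (l :: m) = Φ (m ++ [l])) (a b : List X) : Φ (a ++ b) = Φ (b ++ a) := by
  induction a generalizing b with
  | nil => simp
  | cons l a ih => rw [List.cons_append, h, List.append_assoc, ih]; simp

/-- If `u m = Φ (x m) = -Ψ (y m)` for two cyclically invariant functions `Φ`, `Ψ` of words in
`x` and `y`, then `u` is symmetric in the last two letters. -/
theorem swap_of_cyclic {u Φ Ψ : List X → R} {x y : X} (hxy : ∀ l, l = x ∨ l = y)
    (hΦ : ∀ l m, Φ (l :: m) = Φ (m ++ [l])) (hΨ : ∀ l m, Ψ (l :: m) = Ψ (m ++ [l]))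
    (hx : ∀ m, Φ (x :: m) = u m) (hy : ∀ m, Ψ (y :: m) = -u m) (p : List X) (i j : X) :
    u (p ++ [i, j]) = u (p ++ [j, i]) := by
  have h1 : ∀ a l b, u (a ++ l :: b) = u (b ++ l :: a) := by
    intro a l b
    rcases hxy l with rfl | rfl
    · rw [← hx, ← hx, ← List.cons_append, append_comm_of_cons_eq_concat hΦ]; rfl
    · rw [← neg_inj, ← hy, ← hy, ← List.cons_append, append_comm_of_cons_eq_concat hΨ]; rfl
  have h2 : ∀ l b, u (l :: b) = u (b ++ [l]) := fun l b => h1 [] l b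
  rw [h1 p i [j], List.cons_append, h2, List.nil_append, List.cons_append, h2]
  simp

/-- Injectivity of the coordinate map on the kernel of `(u, v) ↦ ⁅x, u⁆ + ⁅y, v⁆` for the free Lie
algebra on `x` and `y`. In the free associative algebra the two relations say that
`x u + y v` and `x w - y u` are cyclically invariant. -/
theorem eq_zero_of_lie_add_lie_eq_zero {n : ℕ} (h2 : 2 ≤ n) (hn : IsUnit (n : R)) {x y : X}
    (hne : x ≠ y) (hxy : ∀ l, l = x ∨ l = y) {u v w : FreeLieAlgebra R X}
    (hu : u ∈ weight R n) (hv : v ∈ weight R n) (hw : w ∈ weight R n)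
    (h : ⁅of R x, u⁆ + ⁅of R y, v⁆ = 0) (h' : ⁅of R x, w⁆ - ⁅of R y, u⁆ = 0) :
    u = 0 ∧ v = 0 ∧ w = 0 := by
  have hu0 : u = 0 := by
    refine eq_zero_of_swap h2 hn hu (swap_of_cyclic hxy
      (Φ := wc (single (FreeMonoid.of x) 1 * assoc R u + single (FreeMonoid.of y) 1 * assoc R v))
      (Ψ := wc (single (FreeMonoid.of x) 1 * assoc R w - single (FreeMonoid.of y) 1 * assoc R u))
      ?_ ?_ ?_ ?_)
    · have h1 := congrArg (assoc R) h
      rw [map_add, assoc_lie, assoc_lie, assoc_of, assoc_of, map_zero, add_comm_sub, ← sub_eq_zero]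
        at h1
      have h3 : single (FreeMonoid.of x) 1 * assoc R u + single (FreeMonoid.of y) 1 * assoc R v =
          assoc R u * single (FreeMonoid.of x) 1 + assoc R v * single (FreeMonoid.of y) 1 := by
        rw [← sub_eq_zero, ← h1]; abel
      intro l m
      nth_rw 2 [h3]
      rcases hxy l with rfl | rfl
      · rw [wc_add, wc_add, wc_of_mul_cons, wc_of_mul_cons_ne hne.symm, wc_mul_of_concat,
          wc_mul_of_concat_ne hne.symm]
      · rw [wc_add, wc_add, wc_of_mul_cons, wc_of_mul_cons_ne hne, wc_mul_of_concat,
          wc_mul_of_concat_ne hne]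
    · have h1 := congrArg (assoc R) h'
      rw [map_sub, assoc_lie, assoc_lie, assoc_of, assoc_of, map_zero] at h1
      have h3 : single (FreeMonoid.of x) 1 * assoc R w - single (FreeMonoid.of y) 1 * assoc R u =
          assoc R w * single (FreeMonoid.of x) 1 - assoc R u * single (FreeMonoid.of y) 1 := by
        rw [← sub_eq_zero, ← h1]; abel
      intro l m
      nth_rw 2 [h3]
      rcases hxy l with rfl | rfl
      · rw [wc_sub, wc_sub, wc_of_mul_cons, wc_of_mul_cons_ne hne.symm, wc_mul_of_concat,
          wc_mul_of_concat_ne hne.symm]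
      · rw [wc_sub, wc_sub, wc_of_mul_cons, wc_of_mul_cons_ne hne, wc_mul_of_concat,
          wc_mul_of_concat_ne hne]
    · intro m
      rw [wc_add, wc_of_mul_cons, wc_of_mul_cons_ne hne.symm, add_zero]
    · intro m
      rw [wc_sub, wc_of_mul_cons, wc_of_mul_cons_ne hne, zero_sub]
  subst hu0
  exact ⟨rfl, eq_zero_of_lie_of_eq_zero h2 hn hv y (by simpa using h),
    eq_zero_of_lie_of_eq_zero h2 hn hw x (by simpa using h')⟩

/-- In weight `n ≤ c` the free Lie algebra meets `γ_{c+1}` trivially. -/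
theorem eq_zero_of_mem_lowerCentralSeries {n c : ℕ} (hc : n ≤ c) (hn : IsUnit (n : R))
    {z : FreeLieAlgebra R X} (hz : z ∈ weight R n)
    (h : z ∈ LieModule.lowerCentralSeries R (FreeLieAlgebra R X) (FreeLieAlgebra R X) c) :
    z = 0 := by
  refine eq_zero_of_dynkin_eq_zero hn hz ?_
  suffices assoc R z = 0 by rw [this, map_zero]
  refine MonoidAlgebra.ext (Finsupp.ext fun m => ?_)
  change wc (assoc R z) m.toList = 0
  rcases eq_or_ne m.toList.length n with h1 | h1
  · exact wc_assoc_eq_zero (lowerCentralSeries_le_bracketSpan c h) (by simp; omega)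
  · exact wc_assoc_eq_zero hz h1

/-- The coefficients of an element of the `c`-th term of the lower central series vanish on words
of length at most `c`. -/
theorem wc_assoc_eq_zero_of_mem_lowerCentralSeries {c : ℕ} {z : FreeLieAlgebra R X}
    (h : z ∈ LieModule.lowerCentralSeries R (FreeLieAlgebra R X) (FreeLieAlgebra R X) c)
    {m : List X} (hm : m.length ≤ c) : wc (assoc R z) m = 0 :=
  wc_assoc_eq_zero (lowerCentralSeries_le_bracketSpan c h) (by simpa using hm)

/-- The coefficients of the right-normed brackets are integers that do not depend on the ring. -/
theorem exists_int_wc_assoc_bracket (m w : List X) :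
    ∃ e : ℤ, ∀ (R : Type) [CommRing R], wc (assoc R (bracket R m)) w = (e : R) := by
  induction m generalizing w with
  | nil => exact ⟨0, fun R _ => by simp⟩
  | cons i m ih =>
    rcases eq_or_ne m [] with rfl | hm
    · rcases eq_or_ne w [i] with rfl | hw
      · refine ⟨1, fun R _ => ?_⟩
        rw [bracket_singleton, assoc_of, Int.cast_one]
        exact wc_single_self [i] 1
      · refine ⟨0, fun R _ => ?_⟩
        rw [bracket_singleton, assoc_of, Int.cast_zero]
        exact wc_single_of_ne (m := [i]) hw 1
    · have h1 : ∃ e : ℤ, ∀ (R : Type) [CommRing R],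
          wc (single (FreeMonoid.of i) 1 * assoc R (bracket R m)) w = (e : R) := by
        cases w with
        | nil => exact ⟨0, fun R _ => by rw [wc_of_mul_nil, Int.cast_zero]⟩
        | cons j w =>
          rcases eq_or_ne i j with rfl | hij
          · obtain ⟨e, he⟩ := ih w
            exact ⟨e, fun R _ => by rw [wc_of_mul_cons, he]⟩
          · exact ⟨0, fun R _ => by rw [wc_of_mul_cons_ne hij, Int.cast_zero]⟩
      have h2 : ∃ e : ℤ, ∀ (R : Type) [CommRing R],
          wc (assoc R (bracket R m) * single (FreeMonoid.of i) 1) w = (e : R) := by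
        rcases List.eq_nil_or_concat w with rfl | ⟨w, j, rfl⟩
        · exact ⟨0, fun R _ => by rw [wc_mul_of_nil, Int.cast_zero]⟩
        · rw [List.concat_eq_append]
          rcases eq_or_ne i j with rfl | hij
          · obtain ⟨e, he⟩ := ih w
            exact ⟨e, fun R _ => by rw [wc_mul_of_concat, he]⟩
          · exact ⟨0, fun R _ => by rw [wc_mul_of_concat_ne hij, Int.cast_zero]⟩
      obtain ⟨e, he⟩ := h1
      obtain ⟨e', he'⟩ := h2
      refine ⟨e - e', fun R _ => ?_⟩
      rw [bracket_cons R i hm, assoc_lie, assoc_of, wc_sub, he, he', Int.cast_sub]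

/-! ### Dimensions -/

section Finrank

variable [Fintype X]

omit [Fintype X] in
theorem weight_eq_span_range (R : Type*) [CommRing R] (n : ℕ) :
    (weight R n : Submodule R (FreeLieAlgebra R X)) =
      Submodule.span R (Set.range fun m : List.Vector X n => bracket R m.1) := by
  refine congrArg (Submodule.span R) (Set.ext fun z => ⟨?_, ?_⟩)
  · rintro ⟨m, hm, rfl⟩
    exact ⟨⟨m, hm⟩, rfl⟩
  · rintro ⟨m, rfl⟩
    exact ⟨m.1, m.2, rfl⟩

theorem finrank_weight_le (F : Type*) [Field F] (n : ℕ) :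
    finrank F (weight F n : Submodule F (FreeLieAlgebra F X)) ≤ Fintype.card X ^ n := by
  rw [weight_eq_span_range, ← card_vector]
  exact finrank_range_le_card (R := F) (fun m : List.Vector X n => bracket F m.1)

variable (X) in
/-- The trace of the Dynkin operator on words of length `n` is `n` times the dimension of its image;
as its matrix is integral, the trace is the image of an integer. -/
theorem exists_int_mul_finrank_weight (n : ℕ) : ∃ T : ℤ, ∀ (F : Type) [Field F],
    (n : F) * (finrank F (weight F n : Submodule F (FreeLieAlgebra F X)) : F) = (T : F) := by
  classical
  choose e he using fun m w : List X => exists_int_wc_assoc_bracket m w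
  refine ⟨∑ m : List.Vector X n, e m.1 m.1, fun F _ => ?_⟩
  have hfin : FiniteDimensional F (weight F n : Submodule F (FreeLieAlgebra F X)) := by
    rw [weight_eq_span_range]
    exact FiniteDimensional.span_of_finite F (Set.finite_range _)
  let S : (weight F n : Submodule F (FreeLieAlgebra F X)) →ₗ[F] (List.Vector X n → F) :=
    { toFun := fun z m => wc (assoc F z.1) m.1
      map_add' := fun y z => by ext m; simp
      map_smul' := fun t z => by ext m; simp }
  let D : (List.Vector X n → F) →ₗ[F] (weight F n : Submodule F (FreeLieAlgebra F X)) :=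
    Fintype.linearCombination F fun m => ⟨bracket F m.1, bracket_mem m.2⟩
  have hDS : D ∘ₗ S = (n : F) • LinearMap.id := by
    refine LinearMap.ext fun z => Subtype.ext ?_
    let ε : List.Vector X n ↪ FreeMonoid X :=
      ⟨fun m => FreeMonoid.ofList m.1, fun _ _ h => Subtype.ext h⟩
    have hsupp : (assoc F z.1).coeff.support ⊆ Finset.univ.map ε := by
      intro m hm
      rw [Finset.mem_map]
      refine ⟨⟨m.toList, ?_⟩, Finset.mem_univ _, rfl⟩
      by_contra h
      exact Finsupp.mem_support_iff.1 hm (wc_assoc_eq_zero z.2 h)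
    rw [LinearMap.smul_apply, LinearMap.id_apply, Submodule.coe_smul, Nat.cast_smul_eq_nsmul,
      ← dynkin_assoc z.2, dynkin_apply,
      Finsupp.sum_of_support_subset _ hsupp
        (fun m r => r • bracket F m.toList) (fun m _ => zero_smul F _), Finset.sum_map]
    simp only [LinearMap.comp_apply, D, S, Fintype.linearCombination_apply, Submodule.coe_sum,
      Submodule.coe_smul]
    rfl
  have h1 := LinearMap.trace_comp_comm' S D
  rw [hDS, map_smul, LinearMap.trace_id, smul_eq_mul] at h1
  rw [h1, LinearMap.trace_eq_matrix_trace F (Pi.basisFun F _), Matrix.trace, Int.cast_sum]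
  refine Finset.sum_congr rfl fun m _ => ?_
  rw [Matrix.diag_apply, LinearMap.toMatrix_apply, ← he m.1 m.1 F]
  simp [D, S]

variable (X) in
/-- The dimension of the weight-`n` component is the same for almost all primes. -/
theorem exists_finrank_weight_eq {n : ℕ} (hn : 1 ≤ n) : ∃ d N : ℕ, ∀ (p : ℕ) [Fact p.Prime],
    N ≤ p → finrank (ZMod p) (weight (ZMod p) n : Submodule _ (FreeLieAlgebra (ZMod p) X)) = d := by
  obtain ⟨T, hT⟩ := exists_int_mul_finrank_weight X n
  -- beyond this bound `p` exceeds `|n * d - T|`, so the congruence modulo `p` is an equality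
  refine ⟨(T / n).toNat, n * Fintype.card X ^ n + T.natAbs + 1, fun p _ hp => ?_⟩
  have h1 := hT (ZMod p)
  have h2 := finrank_weight_le (X := X) (ZMod p) n
  set d := finrank (ZMod p) (weight (ZMod p) n : Submodule _ (FreeLieAlgebra (ZMod p) X))
  have h3 : (p : ℤ) ∣ (n * d : ℕ) - T := by
    rw [← ZMod.intCast_zmod_eq_zero_iff_dvd]
    push_cast
    rw [h1, sub_self]
  have h4 : n * d ≤ n * Fintype.card X ^ n := Nat.mul_le_mul_left n h2
  have h5 : ((n * d : ℕ) : ℤ) - T = 0 := Int.eq_zero_of_abs_lt_dvd h3 (by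
    rw [abs_lt]; omega)
  have h6 : T = n * d := by push_cast at h5; omega
  rw [h6, Int.mul_ediv_cancel_left _ (by omega), Int.toNat_natCast]

end Finrank

end FreeLieAlgebra

namespace FreeNilpotentLie

open FreeLieAlgebra (weight bracket bracketSpan of)

/-! ### The components of the free nilpotent Lie algebra -/

section Components

variable {R : Type} [CommRing R] {c : ℕ}

variable (R c) in
/-- The projection from the free Lie algebra. -/
def proj : FreeLieAlgebra R (Fin 2) →ₗ[R] FreeNilpotentLie R c :=
  (LieSubmodule.Quotient.mk' (LieModule.lowerCentralSeries R (FreeLieAlgebra R (Fin 2))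
    (FreeLieAlgebra R (Fin 2)) c) : FreeLieAlgebra R (Fin 2) →ₗ[R] FreeNilpotentLie R c)

theorem proj_surjective : Function.Surjective (proj R c) :=
  LieSubmodule.Quotient.surjective_mk' _

theorem proj_of (i : Fin 2) : proj R c (of R i) = gen R c i := rfl

theorem proj_lie (y z : FreeLieAlgebra R (Fin 2)) : proj R c ⁅y, z⁆ = ⁅proj R c y, proj R c z⁆ :=
  rfl

theorem proj_eq_zero {z : FreeLieAlgebra R (Fin 2)} :
    proj R c z = 0 ↔ z ∈ LieModule.lowerCentralSeries R (FreeLieAlgebra R (Fin 2))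
      (FreeLieAlgebra R (Fin 2)) c :=
  LieSubmodule.Quotient.mk_eq_zero _

theorem component_eq_map_weight (k : ℕ) : component R c k = (weight R k).map (proj R c) := by
  refine le_antisymm (Submodule.span_le.2 fun w hw => ?_) ?_
  · induction hw with
    | gen i => exact ⟨of R i, FreeLieAlgebra.bracket_mem (m := [i]) rfl, rfl⟩
    | lie _ _ hv hw =>
      obtain ⟨y, hy, rfl⟩ := hv
      obtain ⟨z, hz, rfl⟩ := hw
      exact ⟨⁅y, z⁆, FreeLieAlgebra.lie_mem_bracketSpan
        (fun a ha b hb => by simp_all) hy hz, proj_lie y z⟩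
  · rw [weight, bracketSpan, Submodule.map_span, Submodule.span_le]
    rintro _ ⟨_, ⟨m, hm, rfl⟩, rfl⟩
    have h : ∀ m : List (Fin 2), m ≠ [] → IsMonomial R c m.length (proj R c (bracket R m)) := by
      intro m
      induction m with
      | nil => exact fun h => absurd rfl h
      | cons i m ih =>
        intro _
        rcases eq_or_ne m [] with rfl | h
        · exact IsMonomial.gen i
        · rw [FreeLieAlgebra.bracket_cons R i h, proj_lie, List.length_cons, add_comm]
          exact (IsMonomial.gen i).lie (ih h)
    rcases eq_or_ne m [] with rfl | h0
    · simp
    · rw [← (hm : m.length = k)]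
      exact Submodule.subset_span (h m h0)

theorem component_eq_bot {k : ℕ} (h : c < k) : component R c k = ⊥ := by
  rw [component_eq_map_weight, weight, bracketSpan, Submodule.map_span, Submodule.span_eq_bot]
  rintro _ ⟨_, ⟨m, hm, rfl⟩, rfl⟩
  have hm' : m.length = k := hm
  exact proj_eq_zero.2 (LieModule.antitone_lowerCentralSeries R _ _ (by omega)
    (FreeLieAlgebra.bracket_mem_lowerCentralSeries m))

theorem gen_lie_mem_component (i : Fin 2) {k : ℕ} {z : FreeNilpotentLie R c}
    (hz : z ∈ component R c k) : ⁅gen R c i, z⁆ ∈ component R c (k + 1) := by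
  rw [component_eq_map_weight] at hz ⊢
  obtain ⟨z, hz, rfl⟩ := hz
  exact ⟨_, FreeLieAlgebra.lie_of_mem_weight i hz, proj_lie _ _⟩

variable (R c) in
/-- The adjoint action of a generator, as a map `L_k → L_{k+1}`. -/
def adGen (k : ℕ) (i : Fin 2) : component R c k →ₗ[R] component R c (k + 1) :=
  (LieAlgebra.ad R (FreeNilpotentLie R c) (gen R c i)).restrict fun _ hz =>
    gen_lie_mem_component i hz

@[simp] theorem coe_adGen (k : ℕ) (i : Fin 2) (z : component R c k) :
    (adGen R c k i z : FreeNilpotentLie R c) = ⁅gen R c i, (z : FreeNilpotentLie R c)⁆ := rfl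

theorem range_adGen_sup_range_adGen {k : ℕ} (hk : 1 ≤ k) :
    LinearMap.range (adGen R c k 0) ⊔ LinearMap.range (adGen R c k 1) = ⊤ := by
  rw [eq_top_iff]
  have h : component R c (k + 1) ≤ (LinearMap.range (adGen R c k 0) ⊔
      LinearMap.range (adGen R c k 1)).map (component R c (k + 1)).subtype := by
    conv_lhs => rw [component_eq_map_weight, weight, bracketSpan, Submodule.map_span]
    rw [Submodule.span_le]
    rintro _ ⟨_, ⟨m, hm, rfl⟩, rfl⟩
    have hm' : m.length = k + 1 := hm
    cases m with
    | nil => simp at hm'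
    | cons i m =>
      rw [List.length_cons, Nat.add_right_cancel_iff] at hm'
      have h0 : m ≠ [] := by rintro rfl; simp at hm'; omega
      have h1 : proj R c (bracket R m) ∈ component R c k := by
        rw [component_eq_map_weight]
        exact ⟨_, FreeLieAlgebra.bracket_mem hm', rfl⟩
      rw [FreeLieAlgebra.bracket_cons R i h0, proj_lie, proj_of]
      have h2 : adGen R c k i ⟨_, h1⟩ ∈ LinearMap.range (adGen R c k 0) ⊔
          LinearMap.range (adGen R c k 1) := by
        fin_cases i
        · exact Submodule.mem_sup_left ⟨_, rfl⟩
        · exact Submodule.mem_sup_right ⟨_, rfl⟩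
      exact ⟨_, h2, rfl⟩
  intro z _
  obtain ⟨y, hy, hyz⟩ := h z.2
  rwa [Subtype.ext hyz] at hy

/-- In weight at most `c`, the projection is injective. -/
theorem eq_zero_of_proj_eq_zero {k : ℕ} (hk : k ≤ c) (hu : IsUnit (k : R))
    {z : FreeLieAlgebra R (Fin 2)} (hz : z ∈ weight R k) (h : proj R c z = 0) : z = 0 :=
  FreeLieAlgebra.eq_zero_of_mem_lowerCentralSeries hk hu hz (proj_eq_zero.1 h)

theorem adGen_injectivity {k : ℕ} (hk : 2 ≤ k) (hkc : k + 1 ≤ c) (hu : IsUnit (k : R))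
    (hu' : IsUnit ((k + 1 : ℕ) : R)) (d e : component R c k × component R c k)
    (hd : adGen R c k 0 d.1 + adGen R c k 1 d.2 = 0)
    (he : adGen R c k 0 e.1 + adGen R c k 1 e.2 = 0) (hde : d.1 + e.2 = 0) : d = 0 ∧ e = 0 := by
  obtain ⟨⟨u, hu1⟩, ⟨v, hv1⟩⟩ := d
  obtain ⟨⟨w, hw1⟩, u'⟩ := e
  obtain rfl : u' = -⟨u, hu1⟩ := (neg_eq_of_add_eq_zero_right hde).symm
  rw [map_neg, ← sub_eq_add_neg] at he
  have hd' := congrArg Subtype.val hd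
  have he' := congrArg Subtype.val he
  simp only [Submodule.coe_add, Submodule.coe_sub, coe_adGen, Submodule.coe_zero] at hd' he'
  have hu2 := hu1
  have hv2 := hv1
  have hw2 := hw1
  rw [component_eq_map_weight] at hu2 hv2 hw2
  obtain ⟨u, hu2, rfl⟩ := hu2
  obtain ⟨v, hv2, rfl⟩ := hv2
  obtain ⟨w, hw2, rfl⟩ := hw2
  rw [← proj_of, ← proj_of, ← proj_lie, ← proj_lie, ← map_add] at hd'
  rw [← proj_of, ← proj_of, ← proj_lie, ← proj_lie, ← map_sub] at he'
  obtain ⟨rfl, rfl, rfl⟩ := FreeLieAlgebra.eq_zero_of_lie_add_lie_eq_zero hk hu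
    (x := (0 : Fin 2)) (y := 1) (by decide) (by decide) hu2 hv2 hw2
    (eq_zero_of_proj_eq_zero hkc hu' (add_mem (FreeLieAlgebra.lie_of_mem_weight _ hu2)
      (FreeLieAlgebra.lie_of_mem_weight _ hv2)) hd')
    (eq_zero_of_proj_eq_zero hkc hu' (sub_mem (FreeLieAlgebra.lie_of_mem_weight _ hw2)
      (FreeLieAlgebra.lie_of_mem_weight _ hu2)) he')
  constructor
  · refine Prod.ext (Subtype.ext ?_) (Subtype.ext ?_) <;> simp
  · refine Prod.ext (Subtype.ext ?_) (Subtype.ext ?_) <;> simp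

variable (R) in
/-- The component of weight `k ≤ c` of the free nilpotent Lie algebra is that of the free one. -/
def weightEquiv {k : ℕ} (hk : k ≤ c) (hu : IsUnit (k : R)) :
    (weight R k : Submodule R (FreeLieAlgebra R (Fin 2))) ≃ₗ[R] component R c k :=
  LinearEquiv.ofBijective
    ((proj R c).restrict (p := weight R k) (q := component R c k) fun z hz => by
      rw [component_eq_map_weight]; exact ⟨z, hz, rfl⟩) <| by
    constructor
    · rw [injective_iff_map_eq_zero]
      exact fun z hz => Subtype.ext (eq_zero_of_proj_eq_zero hk hu z.2 (congrArg Subtype.val hz))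
    · rintro ⟨y, hy⟩
      rw [component_eq_map_weight] at hy
      obtain ⟨z, hz, rfl⟩ := hy
      exact ⟨⟨z, hz⟩, rfl⟩

/-- The components of weight at most `c` are independent. -/
theorem eq_of_sum_mem_component (hunit : ∀ k, 1 ≤ k → k ≤ c → IsUnit (k : R)) {j : ℕ}
    (hj : j ∈ Finset.Icc 1 c) {x : FreeNilpotentLie R c} (hx : x ∈ component R c j)
    {y : ℕ → FreeNilpotentLie R c} (hy : ∀ i, y i ∈ component R c i)
    (hxy : ∑ i ∈ Finset.Icc 1 c, y i = x) : y j = x := by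
  rw [component_eq_map_weight] at hx
  simp only [component_eq_map_weight] at hy
  obtain ⟨x, hx, rfl⟩ := hx
  choose z hz hzy using hy
  obtain rfl : (fun i => proj R c (z i)) = y := funext hzy
  clear hzy
  rw [← map_sum, ← sub_eq_zero, ← map_sub, proj_eq_zero] at hxy
  have h0 : z j - x = 0 := by
    refine FreeLieAlgebra.eq_zero_of_dynkin_eq_zero
      (hunit j (Finset.mem_Icc.1 hj).1 (Finset.mem_Icc.1 hj).2) (sub_mem (hz j) hx) ?_
    suffices FreeLieAlgebra.assoc R (z j - x) = 0 by rw [this, map_zero]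
    refine MonoidAlgebra.ext (Finsupp.ext fun m => ?_)
    change FreeLieAlgebra.wc (FreeLieAlgebra.assoc R (z j - x)) m.toList = 0
    by_cases hm : m.toList.length = j
    · have h1 := FreeLieAlgebra.wc_assoc_eq_zero_of_mem_lowerCentralSeries hxy
        (m := m.toList) (hm ▸ (Finset.mem_Icc.1 hj).2)
      rw [← Finset.add_sum_erase _ _ hj, add_sub_right_comm, map_add, FreeLieAlgebra.wc_add] at h1
      rw [← h1, left_eq_add, map_sum]
      have h2 : ∀ i ∈ (Finset.Icc 1 c).erase j,
          FreeLieAlgebra.wc (FreeLieAlgebra.assoc R (z i)) m.toList = 0 := fun i hi =>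
        FreeLieAlgebra.wc_assoc_eq_zero (hz i) (by
          rw [hm]; exact (Finset.ne_of_mem_erase hi).symm)
      rw [FreeLieAlgebra.wc_sum]
      exact Finset.sum_eq_zero h2
    · exact FreeLieAlgebra.wc_assoc_eq_zero (sub_mem (hz j) hx) hm
  exact congrArg (proj R c) (sub_eq_zero.1 h0)

/-! ### One-step graded ideals as pairs of subspaces -/

/-- The homogeneous parts of an ideal given by homogeneous parts. -/
theorem part_eq_of_eq_iSup (hunit : ∀ k, 1 ≤ k → k ≤ c → IsUnit (k : R))
    {I : LieIdeal R (FreeNilpotentLie R c)} {J : ℕ → Submodule R (FreeNilpotentLie R c)}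
    (hJ : ∀ j, J j ≤ component R c j) (hI : I.toSubmodule = ⨆ j ∈ Finset.Icc 1 c, J j) {j : ℕ}
    (hj : j ∈ Finset.Icc 1 c) : part I j = J j := by
  refine le_antisymm ?_ (le_inf (hI ▸ le_iSup₂_of_le j hj le_rfl) (hJ j))
  rintro x ⟨hxI, hx⟩
  rw [hI] at hxI
  obtain ⟨y, hy⟩ := (Submodule.mem_iSup_finset_iff_exists_sum _ _).1 hxI
  rw [← eq_of_sum_mem_component hunit hj hx (fun i => hJ i (y i).2) hy]
  exact (y j).2

theorem mem_of_forall_gen_lie_mem {S : Submodule R (FreeNilpotentLie R c)}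
    (h : ∀ i, ∀ y ∈ S, ⁅gen R c i, y⁆ ∈ S) (x : FreeNilpotentLie R c)
    {y : FreeNilpotentLie R c} (hy : y ∈ S) : ⁅x, y⁆ ∈ S := by
  obtain ⟨x, rfl⟩ := proj_surjective x
  let K : LieSubalgebra R (FreeLieAlgebra R (Fin 2)) :=
    { carrier := {z | ∀ y ∈ S, ⁅proj R c z, y⁆ ∈ S}
      add_mem' := fun {a b} ha hb y hy => by
        rw [map_add, add_lie]; exact add_mem (ha y hy) (hb y hy)
      zero_mem' := fun y _ => by rw [map_zero, zero_lie]; exact zero_mem _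
      smul_mem' := fun t a ha y hy => by
        rw [map_smul, smul_lie]; exact S.smul_mem t (ha y hy)
      lie_mem' := fun {a b} ha hb y hy => by
        rw [proj_lie, lie_lie]
        exact sub_mem (ha _ (hb y hy)) (hb _ (ha y hy)) }
  exact FreeLieAlgebra.lieSubalgebra_eq_top R (K := K) h x y hy

/-- The parts in weights `k` and `k + 1` of an ideal, as subspaces of `L_k` and `L_{k+1}`. -/
def partPair (k : ℕ) (I : LieIdeal R (FreeNilpotentLie R c)) :
    Submodule R (component R c k) × Submodule R (component R c (k + 1)) :=
  (I.toSubmodule.comap (component R c k).subtype,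
    I.toSubmodule.comap (component R c (k + 1)).subtype)

theorem map_subtype_comap_eq_part (j : ℕ) (I : LieIdeal R (FreeNilpotentLie R c)) :
    (I.toSubmodule.comap (component R c j).subtype).map (component R c j).subtype = part I j := by
  rw [Submodule.map_comap_subtype, inf_comm, part]

/-- One-step graded ideals are the same as pairs `A ≤ L_k`, `B ≤ L_{k+1}` with
`⁅L_1, A⁆ ≤ B`. -/
theorem bijOn_partPair (hunit : ∀ k, 1 ≤ k → k ≤ c → IsUnit (k : R)) {k : ℕ} (hk : 1 ≤ k)
    (hkc : k + 1 ≤ c) :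
    Set.BijOn (partPair k) {I : LieIdeal R (FreeNilpotentLie R c) | IsStepGraded R c 1 k I}
      {P | P.1.map (adGen R c k 0) ≤ P.2 ∧ P.1.map (adGen R c k 1) ≤ P.2} := by
  refine ⟨fun I _ => ⟨?_, ?_⟩, fun I hI I' hI' h => ?_, ?_⟩
  · rw [Submodule.map_le_iff_le_comap]
    intro z hz
    exact LieSubmodule.lie_mem I (x := gen R c _) hz
  · rw [Submodule.map_le_iff_le_comap]
    intro z hz
    exact LieSubmodule.lie_mem I (x := gen R c _) hz
  · obtain ⟨J, hJ1, hJ2, hJ3, hJ4⟩ := hI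
    obtain ⟨J', hJ1', hJ2', hJ3', hJ4'⟩ := hI'
    refine LieSubmodule.toSubmodule_injective ?_
    rw [hJ4, hJ4']
    refine iSup_congr fun j => iSup_congr fun hj => ?_
    rcases lt_trichotomy j k with hjk | rfl | hjk
    · rw [hJ2 j hjk, hJ2' j hjk]
    · rw [← part_eq_of_eq_iSup hunit hJ1 hJ4 hj, ← part_eq_of_eq_iSup hunit hJ1' hJ4' hj,
        ← map_subtype_comap_eq_part, ← map_subtype_comap_eq_part]
      exact congrArg _ (congrArg Prod.fst h)
    · rcases (Nat.succ_le_of_lt hjk).eq_or_lt with rfl | hjk'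
      · rw [← part_eq_of_eq_iSup hunit hJ1 hJ4 hj, ← part_eq_of_eq_iSup hunit hJ1' hJ4' hj,
          ← map_subtype_comap_eq_part, ← map_subtype_comap_eq_part]
        exact congrArg _ (congrArg Prod.snd h)
      · rw [hJ3 j hjk', hJ3' j hjk']
  · rintro ⟨A, B⟩ ⟨hA0, hA1⟩
    let J : ℕ → Submodule R (FreeNilpotentLie R c) := fun j =>
      if j < k then ⊥ else if j = k then A.map (component R c k).subtype
      else if j = k + 1 then B.map (component R c (k + 1)).subtype else component R c j
    have hJlt : ∀ j, j < k → J j = ⊥ := fun j hj => if_pos hj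
    have hJk : J k = A.map (component R c k).subtype := by
      simp only [J, lt_irrefl, if_false, if_true]
    have hJk1 : J (k + 1) = B.map (component R c (k + 1)).subtype := by
      simp only [J, show ¬ k + 1 < k by omega, show ¬ k + 1 = k by omega, if_false, if_true]
    have hJgt : ∀ j, k + 1 < j → J j = component R c j := fun j hj => by
      simp only [J, show ¬ j < k by omega, show ¬ j = k by omega, show ¬ j = k + 1 by omega,
        if_false]
    have hJle : ∀ j, J j ≤ component R c j := by
      intro j
      rcases lt_trichotomy j k with hjk | rfl | hjk
      · rw [hJlt j hjk]; exact bot_le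
      · rw [hJk]; exact Submodule.map_subtype_le _ _
      · rcases (Nat.succ_le_of_lt hjk).eq_or_lt with rfl | hjk'
        · exact hJk1.trans_le (Submodule.map_subtype_le _ _)
        · exact (hJgt j hjk').le
    have hstep : ∀ i j, ∀ y ∈ J j, ⁅gen R c i, y⁆ ∈ J (j + 1) := by
      intro i j y hy
      rcases lt_trichotomy j k with hjk | rfl | hjk
      · rw [hJlt j hjk, Submodule.mem_bot] at hy
        have h0 : ⁅gen R c i, (0 : FreeNilpotentLie R c)⁆ = 0 :=
          map_zero (LieAlgebra.ad R (FreeNilpotentLie R c) (gen R c i))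
        rw [hy, h0]; exact zero_mem _
      · rw [hJk] at hy
        obtain ⟨a, ha, rfl⟩ := hy
        rw [hJk1]
        have hi : adGen R c j i a ∈ B := by
          fin_cases i
          · exact hA0 ⟨a, ha, rfl⟩
          · exact hA1 ⟨a, ha, rfl⟩
        exact ⟨_, hi, rfl⟩
      · rw [hJgt (j + 1) (by omega)]
        exact gen_lie_mem_component i (hJle j hy)
    have hle : ∀ j, 1 ≤ j → J j ≤ ⨆ j ∈ Finset.Icc 1 c, J j := by
      intro j hj
      by_cases hjc : j ≤ c
      · exact le_iSup₂_of_le j (Finset.mem_Icc.2 ⟨hj, hjc⟩) le_rfl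
      · exact (hJle j).trans (by rw [component_eq_bot (by omega)]; exact bot_le)
    have hgen : ∀ i, ∀ y ∈ ⨆ j ∈ Finset.Icc 1 c, J j,
        ⁅gen R c i, y⁆ ∈ ⨆ j ∈ Finset.Icc 1 c, J j := by
      intro i
      change (⨆ j ∈ Finset.Icc 1 c, J j) ≤ (⨆ j ∈ Finset.Icc 1 c, J j).comap
        (LieAlgebra.ad R (FreeNilpotentLie R c) (gen R c i))
      exact iSup₂_le fun j _ y hy => hle (j + 1) (by omega) (hstep i j y hy)
    let I : LieIdeal R (FreeNilpotentLie R c) :=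
      { (⨆ j ∈ Finset.Icc 1 c, J j : Submodule R (FreeNilpotentLie R c)) with
        lie_mem := fun {x y} hy => mem_of_forall_gen_lie_mem hgen x hy }
    have hI : I.toSubmodule = ⨆ j ∈ Finset.Icc 1 c, J j := rfl
    refine ⟨I, ⟨J, hJle, hJlt, hJgt, hI⟩, Prod.ext ?_ ?_⟩
    · refine Submodule.map_injective_of_injective (component R c k).subtype_injective ?_
      rw [← hJk, ← part_eq_of_eq_iSup hunit hJle hI (Finset.mem_Icc.2 ⟨hk, by omega⟩)]
      exact map_subtype_comap_eq_part k I
    · refine Submodule.map_injective_of_injective (component R c (k + 1)).subtype_injective ?_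
      rw [← hJk1, ← part_eq_of_eq_iSup hunit hJle hI (Finset.mem_Icc.2 ⟨by omega, hkc⟩)]
      exact map_subtype_comap_eq_part (k + 1) I

end Components

/-! ### Counting one-step graded ideals -/

/-- In weight `1` every nonzero subspace generates `L_2`. -/
theorem map_adGen_one_sup_eq_top {F : Type} [Field F] {c : ℕ}
    (A : Submodule F (component F c 1)) (hA : A ≠ ⊥) :
    A.map (adGen F c 1 0) ⊔ A.map (adGen F c 1 1) = ⊤ := by
  obtain ⟨a, haA, ha⟩ := Submodule.exists_mem_ne_zero_of_ne_bot hA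
  have hgen : ∀ i, gen F c i ∈ component F c 1 := fun i =>
    Submodule.subset_span (IsMonomial.gen i)
  -- the elements of weight one are the combinations of the two generators
  have hone : ∀ z : component F c 1, ∃ α β : F,
      z = α • (⟨_, hgen 0⟩ : component F c 1) + β • ⟨_, hgen 1⟩ := by
    rintro ⟨z, hz⟩
    suffices ∃ α β : F, α • gen F c 0 + β • gen F c 1 = z by
      obtain ⟨α, β, h⟩ := this
      exact ⟨α, β, Subtype.ext h.symm⟩
    rw [← Submodule.mem_span_pair]
    rw [component_eq_map_weight, weight, bracketSpan, Submodule.map_span] at hz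
    refine Submodule.span_mono ?_ hz
    rintro _ ⟨_, ⟨m, hm, rfl⟩, rfl⟩
    obtain ⟨i, rfl⟩ := List.length_eq_one_iff.1 (hm : m.length = 1)
    fin_cases i
    · exact Or.inl rfl
    · exact Or.inr rfl
  set x : component F c 1 := ⟨_, hgen 0⟩
  set y : component F c 1 := ⟨_, hgen 1⟩
  set X := adGen F c 1 0
  set Y := adGen F c 1 1
  have hXx : X x = 0 := Subtype.ext (lie_self (gen F c 0))
  have hYy : Y y = 0 := Subtype.ext (lie_self (gen F c 1))
  have hYx : Y x = -X y := Subtype.ext (lie_skew (gen F c 1) (gen F c 0)).symm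
  obtain ⟨α, β, hαβ⟩ := hone a
  have hXa : X a = β • X y := by rw [hαβ]; simp [hXx]
  have hYa : Y a = -(α • X y) := by rw [hαβ]; simp [hYy, hYx]
  have hmem : X y ∈ A.map X ⊔ A.map Y := by
    rcases eq_or_ne β 0 with rfl | hβ
    · have hα : α ≠ 0 := by rintro rfl; exact ha (by rw [hαβ]; simp)
      refine Submodule.mem_sup_right ⟨-α⁻¹ • a, A.smul_mem _ haA, ?_⟩
      rw [map_smul, hYa, smul_neg, neg_smul, neg_neg, smul_smul, inv_mul_cancel₀ hα, one_smul]
    · refine Submodule.mem_sup_left ⟨β⁻¹ • a, A.smul_mem _ haA, ?_⟩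
      rw [map_smul, hXa, smul_smul, inv_mul_cancel₀ hβ, one_smul]
  rw [eq_top_iff, ← range_adGen_sup_range_adGen le_rfl, sup_le_iff]
  constructor
  · rintro _ ⟨z, rfl⟩
    obtain ⟨α, β, rfl⟩ := hone z
    have h : X (α • x + β • y) = β • X y := by simp [hXx]
    exact h ▸ Submodule.smul_mem _ _ hmem
  · rintro _ ⟨z, rfl⟩
    obtain ⟨α, β, rfl⟩ := hone z
    have h : Y (α • x + β • y) = -α • X y := by simp [hYy, hYx]
    exact h ▸ Submodule.smul_mem _ _ hmem

/-- Pairs of total dimension `a`, sorted by their two dimensions. -/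
def pencilPairSigmaEquiv {F U W : Type*} [Field F] [AddCommGroup U] [Module F U]
    [AddCommGroup W] [Module F W] (X Y : U →ₗ[F] W) (a : ℕ) :
    {P : Submodule F U × Submodule F W // (P.1.map X ≤ P.2 ∧ P.1.map Y ≤ P.2) ∧
      finrank F P.1 + finrank F P.2 = a} ≃
    Σ ij : Finset.HasAntidiagonal.antidiagonal a, PencilPair X Y ij.1.1 ij.1.2 where
  toFun P := ⟨⟨(finrank F P.1.1, finrank F P.1.2), Finset.HasAntidiagonal.mem_antidiagonal.2 P.2.2⟩,
    ⟨P.1, P.2.1, rfl, rfl⟩⟩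
  invFun Q := ⟨Q.2.1, Q.2.2.1, by
    rw [Q.2.2.2.1, Q.2.2.2.2]; exact Finset.HasAntidiagonal.mem_antidiagonal.1 Q.1.2⟩
  left_inv _ := rfl
  right_inv := by
    rintro ⟨⟨⟨i, j⟩, h⟩, ⟨P, hP, hi, hj⟩⟩
    dsimp only at hi hj
    subst hi hj
    rfl

section Prime

variable {c p : ℕ} [hp : Fact p.Prime]

theorem isUnit_natCast (hcp : c < p) (k : ℕ) (hk : 1 ≤ k) (hkc : k ≤ c) :
    IsUnit (k : ZMod p) := by
  rw [isUnit_iff_ne_zero, Ne, ZMod.natCast_eq_zero_iff]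
  exact Nat.not_dvd_of_pos_of_lt hk (hkc.trans_lt hcp)

theorem finite_freeNilpotentLie : Finite (FreeNilpotentLie (ZMod p) c) :=
  Module.finite_of_finite (ZMod p)

theorem stepCount_eq_sum (hcp : c < p) {k : ℕ} (hk : 1 ≤ k) (hkc : k + 1 ≤ c) (a : ℕ) :
    stepCount 1 c a k p = ∑ ij ∈ Finset.HasAntidiagonal.antidiagonal a,
      Nat.card (PencilPair (adGen (ZMod p) c k 0) (adGen (ZMod p) c k 1) ij.1 ij.2) := by
  have := finite_freeNilpotentLie (c := c) (p := p)
  have : Finite (Submodule (ZMod p) (component (ZMod p) c k)) :=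
    Finite.of_injective _ SetLike.coe_injective
  have : Finite (Submodule (ZMod p) (component (ZMod p) c (k + 1))) :=
    Finite.of_injective _ SetLike.coe_injective
  have hbij := bijOn_partPair (isUnit_natCast hcp) hk hkc
  have hdim : ∀ I : LieIdeal (ZMod p) (FreeNilpotentLie (ZMod p) c),
      ∑ j ∈ Finset.Icc k (k + 1), finrank (ZMod p) (part I j) =
        finrank (ZMod p) (partPair k I).1 + finrank (ZMod p) (partPair k I).2 := by
    intro I
    rw [Finset.sum_Icc_succ_top (by omega), Finset.Icc_self, Finset.sum_singleton,
      ← map_subtype_comap_eq_part, ← map_subtype_comap_eq_part, Submodule.finrank_map_subtype_eq,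
      Submodule.finrank_map_subtype_eq]
    rfl
  have himage : partPair k '' {I : LieIdeal (ZMod p) (FreeNilpotentLie (ZMod p) c) |
      IsStepGraded (ZMod p) c 1 k I ∧
        ∑ j ∈ Finset.Icc k (k + 1), finrank (ZMod p) (part I j) = a} =
      {P | (P.1.map (adGen (ZMod p) c k 0) ≤ P.2 ∧ P.1.map (adGen (ZMod p) c k 1) ≤ P.2) ∧
        finrank (ZMod p) P.1 + finrank (ZMod p) P.2 = a} := by
    ext P
    constructor
    · rintro ⟨I, ⟨hI, ha⟩, rfl⟩
      exact ⟨hbij.1 hI, by rw [← hdim, ha]⟩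
    · rintro ⟨hP, ha⟩
      obtain ⟨I, hI, rfl⟩ := hbij.2.2 hP
      exact ⟨I, ⟨hI, by rw [hdim, ha]⟩, rfl⟩
  rw [stepCount, ← (hbij.2.1.mono fun I hI => hI.1).ncard_image, himage,
    ← Nat.card_coe_set_eq]
  refine (Nat.card_congr (pencilPairSigmaEquiv _ _ a)).trans ?_
  rw [Nat.card_sigma]
  exact Finset.sum_coe_sort (Finset.HasAntidiagonal.antidiagonal a) fun ij =>
    Nat.card (PencilPair (adGen (ZMod p) c k 0) (adGen (ZMod p) c k 1) ij.1 ij.2)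

end Prime

/-- The components have the same dimension for almost all primes. -/
theorem exists_componentDim_eq {c k : ℕ} (hk : 1 ≤ k) (hkc : k ≤ c) : ∃ d N : ℕ,
    ∀ (p : ℕ) [Fact p.Prime], N ≤ p → componentDim c p k = d := by
  obtain ⟨d, N, h⟩ := FreeLieAlgebra.exists_finrank_weight_eq (Fin 2) hk
  refine ⟨d, max N (c + 1), fun p _ hp => ?_⟩
  rw [componentDim, ← h p (le_of_max_le_left hp)]
  exact (weightEquiv (ZMod p) hkc (isUnit_natCast
    (Nat.lt_of_succ_le (le_of_max_le_right hp)) k hk hkc)).finrank_eq.symm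

/-- The number of one-step graded ideals of given dimension is a polynomial in `p`, for almost all
primes. -/
theorem exists_polynomial_stepCount {c k : ℕ} (hk : 1 ≤ k) (hkc : k + 1 ≤ c) (a : ℕ) :
    ∃ (P : Polynomial ℤ) (N : ℕ), ∀ (p : ℕ) [Fact p.Prime], N ≤ p →
      (stepCount 1 c a k p : ℤ) = P.eval (p : ℤ) := by
  obtain ⟨d, N, hd⟩ := exists_componentDim_eq (c := c) hk (by omega)
  obtain ⟨d', N', hd'⟩ := exists_componentDim_eq (k := k + 1) (by omega) hkc
  have key : ∀ i j : ℕ, ∃ P : Polynomial ℤ, ∀ (p : ℕ) [Fact p.Prime], N ≤ p → N' ≤ p → c < p →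
      (Nat.card (PencilPair (adGen (ZMod p) c k 0) (adGen (ZMod p) c k 1) i j) : ℤ) =
        P.eval (p : ℤ) := by
    intro i j
    rcases hk.eq_or_lt with rfl | hk2
    · obtain ⟨P, hP⟩ := exists_polynomial_card_pencilPair_of_forall_ne_bot d d' i j
      refine ⟨P, fun p _ h1 h2 h3 => ?_⟩
      have := finite_freeNilpotentLie (c := c) (p := p)
      rw [hP (ZMod p) _ _ _ _ (hd p h1) (hd' p h2) map_adGen_one_sup_eq_top, ZMod.card]
    · obtain ⟨P, hP⟩ := exists_polynomial_card_pencilPair d d' i j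
      refine ⟨P, fun p _ h1 h2 h3 => ?_⟩
      have := finite_freeNilpotentLie (c := c) (p := p)
      rw [hP (ZMod p) _ _ _ _ (hd p h1) (hd' p h2) (range_adGen_sup_range_adGen hk)
        (adGen_injectivity hk2 hkc (isUnit_natCast h3 k hk (by omega))
          (isUnit_natCast h3 (k + 1) (by omega) hkc)), ZMod.card]
  choose P hP using key
  refine ⟨∑ ij ∈ Finset.HasAntidiagonal.antidiagonal a, P ij.1 ij.2, max (max N N') (c + 1),
    fun p _ hp => ?_⟩
  have h3 : c < p := Nat.lt_of_succ_le (le_of_max_le_right hp)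
  rw [stepCount_eq_sum h3 hk hkc, Nat.cast_sum, Polynomial.eval_finsetSum]
  exact Finset.sum_congr rfl fun ij _ => hP _ _ p
    (le_of_max_le_left (le_of_max_le_left hp)) (le_of_max_le_right (le_of_max_le_left hp)) h3

/-! ### The zeta function -/

section Zeta

variable {c p : ℕ} [hp : Fact p.Prime]

theorem finrank_part_le (I : LieIdeal (ZMod p) (FreeNilpotentLie (ZMod p) c)) (j : ℕ) :
    finrank (ZMod p) (part I j) ≤ componentDim c p j :=
  Submodule.finrank_mono inf_le_right

theorem partIndex_eq_pow (I : LieIdeal (ZMod p) (FreeNilpotentLie (ZMod p) c)) (j : ℕ) :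
    partIndex I j = p ^ (componentDim c p j - finrank (ZMod p) (part I j)) := by
  have h1 : Nat.card (part I j) * partIndex I j = Nat.card (component (ZMod p) c j) := by
    have h := AddSubgroup.relIndex_mul_relIndex ⊥ (part I j).toAddSubgroup
      (component (ZMod p) c j).toAddSubgroup bot_le fun x hx => hx.2
    rwa [AddSubgroup.relIndex_bot_left, AddSubgroup.relIndex_bot_left] at h
  rw [Module.natCard_eq_pow_finrank (K := ZMod p) (V := part I j),
    Module.natCard_eq_pow_finrank (K := ZMod p) (V := component (ZMod p) c j), Nat.card_zmod] at h1
  refine Nat.eq_of_mul_eq_mul_left (pow_pos hp.out.pos (finrank (ZMod p) (part I j))) ?_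
  rw [h1, ← pow_add, Nat.add_sub_cancel' (finrank_part_le I j), componentDim]

theorem natCast_pow_cpow (q n : ℕ) (s : ℂ) : ((q ^ n : ℕ) : ℂ) ^ s = ((q : ℂ) ^ s) ^ n := by
  induction n with
  | zero => simp
  | succ n ih => rw [pow_succ, Nat.cast_mul, Complex.natCast_mul_natCast_cpow, ih, pow_succ]

theorem prod_partIndex_cpow (I : LieIdeal (ZMod p) (FreeNilpotentLie (ZMod p) c)) (k : ℕ) (s : ℂ) :
    ∏ j ∈ Finset.Icc k (k + 1), (partIndex I j : ℂ) ^ (-s) =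
      ((p : ℂ) ^ (-s)) ^ (componentDim c p k + componentDim c p (k + 1) -
        ∑ j ∈ Finset.Icc k (k + 1), finrank (ZMod p) (part I j)) := by
  rw [Finset.prod_Icc_succ_top (by omega), Finset.sum_Icc_succ_top (by omega), Finset.Icc_self,
    Finset.prod_singleton, Finset.sum_singleton, partIndex_eq_pow, partIndex_eq_pow,
    natCast_pow_cpow, natCast_pow_cpow, ← pow_add]
  have := finrank_part_le I k
  have := finrank_part_le I (k + 1)
  congr 1
  omega

theorem finsum_prod_partIndex_cpow (k : ℕ) (s : ℂ) :
    ∑ᶠ I ∈ {I : LieIdeal (ZMod p) (FreeNilpotentLie (ZMod p) c) | IsStepGraded (ZMod p) c 1 k I},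
      ∏ j ∈ Finset.Icc k (k + 1), (partIndex I j : ℂ) ^ (-s) =
    ∑ a ∈ Finset.range (componentDim c p k + componentDim c p (k + 1) + 1),
      (stepCount 1 c a k p : ℂ) *
        ((p : ℂ) ^ (-s)) ^ (componentDim c p k + componentDim c p (k + 1) - a) := by
  classical
  have : Finite (LieIdeal (ZMod p) (FreeNilpotentLie (ZMod p) c)) := finite_lieIdeal c p
  have hfin := Set.toFinite
    {I : LieIdeal (ZMod p) (FreeNilpotentLie (ZMod p) c) | IsStepGraded (ZMod p) c 1 k I}
  rw [finsum_mem_eq_finite_toFinset_sum _ hfin]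
  have hmaps : ∀ I ∈ hfin.toFinset, ∑ j ∈ Finset.Icc k (k + 1), finrank (ZMod p) (part I j) ∈
      Finset.range (componentDim c p k + componentDim c p (k + 1) + 1) := by
    intro I _
    rw [Finset.sum_Icc_succ_top (by omega), Finset.Icc_self, Finset.sum_singleton,
      Finset.mem_range]
    have := finrank_part_le I k
    have := finrank_part_le I (k + 1)
    omega
  rw [← Finset.sum_fiberwise_of_maps_to hmaps]
  refine Finset.sum_congr rfl fun a _ => ?_
  rw [Finset.sum_congr rfl (g := fun _ => ((p : ℂ) ^ (-s)) ^
    (componentDim c p k + componentDim c p (k + 1) - a)), Finset.sum_const, nsmul_eq_mul]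
  · congr 2
    rw [stepCount, ← Set.ncard_coe_finset]
    congr 1
    ext I
    simp
  · intro I hI
    rw [prod_partIndex_cpow, (Finset.mem_filter.1 hI).2]

end Zeta

/-- The contribution of position `k` to the zeta function is a polynomial in `p` and `p^{-s}` for
almost all primes. -/
theorem exists_mvPolynomial_finsum {c k : ℕ} (hk : k ∈ Finset.Icc 1 (c - 1)) :
    ∃ (W : MvPolynomial (Fin 2) ℚ) (N : ℕ), ∀ (p : ℕ) [Fact p.Prime], N ≤ p → ∀ s : ℂ,
      ∑ᶠ I ∈ {I : LieIdeal (ZMod p) (FreeNilpotentLie (ZMod p) c) |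
          IsStepGraded (ZMod p) c 1 k I},
        ∏ j ∈ Finset.Icc k (k + 1), (partIndex I j : ℂ) ^ (-s) =
      MvPolynomial.aeval ![(p : ℂ), (p : ℂ) ^ (-s)] W := by
  rw [Finset.mem_Icc] at hk
  obtain ⟨d, N, hd⟩ := exists_componentDim_eq (c := c) hk.1 (by omega)
  obtain ⟨d', N', hd'⟩ := exists_componentDim_eq (c := c) (k := k + 1) (by omega) (by omega)
  choose P M hP using fun a => exists_polynomial_stepCount (c := c) hk.1 (by omega) a
  refine ⟨∑ a ∈ Finset.range (d + d' + 1),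
    Polynomial.aeval (MvPolynomial.X 0 : MvPolynomial (Fin 2) ℚ) (P a) *
      MvPolynomial.X 1 ^ (d + d' - a),
    max (max N N') ((Finset.range (d + d' + 1)).sup M), fun p _ hp s => ?_⟩
  rw [finsum_prod_partIndex_cpow, hd p (le_of_max_le_left (le_of_max_le_left hp)),
    hd' p (le_of_max_le_right (le_of_max_le_left hp)), map_sum]
  refine Finset.sum_congr rfl fun a ha => ?_
  have h1 := hP a p ((Finset.le_sup ha).trans (le_of_max_le_right hp))
  have h2 : MvPolynomial.aeval ![(p : ℂ), (p : ℂ) ^ (-s)]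
      (Polynomial.aeval (MvPolynomial.X 0 : MvPolynomial (Fin 2) ℚ) (P a)) =
      (stepCount 1 c a k p : ℂ) := by
    rw [← Int.cast_natCast (R := ℂ) (stepCount 1 c a k p), h1]
    have h3 := Polynomial.aeval_algHom_apply
      ((MvPolynomial.aeval ![(p : ℂ), (p : ℂ) ^ (-s)] :
        MvPolynomial (Fin 2) ℚ →ₐ[ℚ] ℂ) : MvPolynomial (Fin 2) ℚ →+* ℂ).toIntAlgHom
      (MvPolynomial.X 0) (P a)
    have h4 := Polynomial.aeval_algebraMap_apply ℂ (p : ℤ) (P a)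
    simp at h3 h4
    exact h3.symm.trans h4
  rw [map_mul, map_pow, h2, MvPolynomial.aeval_X]
  rfl

end FreeNilpotentLie

end

theorem mainTheorem3 (c : ℕ) (hc : 1 ≤ c) :
    (∃ W : MvPolynomial (Fin 2) ℚ,
      ∀ᶠ p : ℕ in Filter.cofinite, p.Prime →
        ∀ s : ℂ, FreeNilpotentLie.stepZeta 1 c p s =
          MvPolynomial.aeval ![(p : ℂ), (p : ℂ) ^ (-s)] W) ∧
    (∀ p : ℕ, p.Prime → ∀ s : ℂ,
      FreeNilpotentLie.stepZeta 1 c p s =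
        ∑ k ∈ Finset.Icc 1 (c - 1),
          ∑ a ∈ Finset.range
              (FreeNilpotentLie.componentDim c p k + FreeNilpotentLie.componentDim c p (k + 1) + 1),
            (FreeNilpotentLie.stepCount 1 c a k p : ℂ) *
              ((p : ℂ) ^ (-s)) ^
                (FreeNilpotentLie.componentDim c p k +
                  FreeNilpotentLie.componentDim c p (k + 1) - a)) := by
  constructor
  · choose W N hW using fun k : Finset.Icc 1 (c - 1) =>
      FreeNilpotentLie.exists_mvPolynomial_finsum k.2
    refine ⟨∑ k, W k, ?_⟩
    rw [Nat.cofinite_eq_atTop]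
    filter_upwards [Filter.eventually_ge_atTop (Finset.univ.sup N)] with p hp hprime s
    have : Fact p.Prime := ⟨hprime⟩
    rw [FreeNilpotentLie.stepZeta, map_sum, ← Finset.sum_coe_sort]
    exact Finset.sum_congr rfl fun k hk => hW k p ((Finset.le_sup hk).trans hp) s
  · intro p hprime s
    have : Fact p.Prime := ⟨hprime⟩
    exact Finset.sum_congr rfl fun k _ => FreeNilpotentLie.finsum_prod_partIndex_cpow k s
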